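/- Let $S$ be a set of $n\ge 4$ points in general position in the Euclidean plane, meaning that no three points of $S$ are collinear and no four points of $S$ are cocircular. For $0\le k\le n-3$ let $c_k$ be the number of circles that pass through three points of $S$ and enclose (contain strictly in their interior) exactly $k$ other points of $S$, and let $p_C(z)=\sum_{k=0}^{n-3}c_kz^k$ be the circle polynomial of $S$. Let $\overline{cr}(S)$ be the rectilinear crossing number of $S$, that is, the number of pairs of edges that cross in the straight-line drawing of the complete graph $K_n$ whose vertices are the points of $S$. Then (1) $p_C(1)=\binom n3$; (2) $p_C'(1)=\binom n4+\overline{cr}(S)$; (3) $p_C''(1)=\binom n5+(n-4)\,\overline{cr}(S)$; (4) $p_C(-1)=\frac{n-1}{2}$ if $n$ is odd. -/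

import Mathlib

/-- The Euclidean plane. -/
abbrev Plane : Type := EuclideanSpace ℝ (Fin 2)

/-- General position: no three points of `S` are collinear and no four points of `S` are
cocircular (in the plane, `Cospherical` means lying on a common circle). -/
def InGeneralPosition (S : Finset Plane) : Prop :=
  (∀ T : Finset Plane, T ⊆ S → T.card = 3 → ¬ Collinear ℝ (T : Set Plane)) ∧
  (∀ T : Finset Plane, T ⊆ S → T.card = 4 → ¬ EuclideanGeometry.Cospherical (T : Set Plane))

/-- The number of points of `S` enclosed by the circle `C`, i.e. strictly inside it. -/
noncomputable def enclosedCount (S : Finset Plane) (C : EuclideanGeometry.Sphere Plane) : ℕ :=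
  {p : Plane | p ∈ S ∧ dist p C.center < C.radius}.ncard

/-- The circles that pass through three (distinct) points of `S` and enclose exactly `k`
points of `S`. -/
def circlesEnclosing (S : Finset Plane) (k : ℕ) : Set (EuclideanGeometry.Sphere Plane) :=
  {C | (∃ T : Finset Plane, T ⊆ S ∧ T.card = 3 ∧ ∀ p ∈ T, p ∈ C) ∧ enclosedCount S C = k}

/-- The number `c_k` of circles through three points of `S` that enclose exactly `k` points
of `S`. -/
noncomputable def circleCount (S : Finset Plane) (k : ℕ) : ℕ :=
  (circlesEnclosing S k).ncard

/-- The circle polynomial `∑_{k=0}^{n-3} c_k z^k` of `S`, where `n` is the number of points. -/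
noncomputable def circlePolynomial (S : Finset Plane) : Polynomial ℂ :=
  ∑ k ∈ Finset.range (S.card - 2), Polynomial.C (circleCount S k : ℂ) * Polynomial.X ^ k

/-- The crossings of the straight-line drawing of the complete graph on `S`: unordered pairs
of distinct edges `pq`, `rs` (which are unordered pairs of distinct points of `S`) whose open
segments have a point in common. -/
def edgeCrossings (S : Finset Plane) : Set (Sym2 (Sym2 Plane)) :=
  {x | ∃ p ∈ S, ∃ q ∈ S, ∃ r ∈ S, ∃ s ∈ S, p ≠ q ∧ r ≠ s ∧ s(p, q) ≠ s(r, s) ∧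
    x = s(s(p, q), s(r, s)) ∧ (openSegment ℝ p q ∩ openSegment ℝ r s).Nonempty}

/-- The rectilinear crossing number of the point set `S`. -/
noncomputable def rectilinearCrossingNumber (S : Finset Plane) : ℕ :=
  (edgeCrossings S).ncard

/-! The core is a statement about each subset `Q` with at least two points
(`farthestCount_add_two`): the triples of `Q` whose circle encloses the rest of `Q` are the
triangles of the farthest-point Delaunay triangulation of the convex hull, so there are two fewer of
them than hull edges. No triangulation is constructed. A linear functional injective on `Q` orders
the points, and each such triple is charged to its middle vertex `v`. Inversion at `v` turns circles
through `v` into lines, and enclosed points become points cut off from `v` by the line. The triples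
charged to `v` become lines that separate the origin from all image points and whose two defining
points lie on opposite sides of a fixed axis. There is one such line if `v` is a hull vertex and
none otherwise, matching the number of hull edges that start at `v`. The two extreme points of the
order are hull vertices and never middle vertices, which accounts for the 2. Summing over all `Q` of
size `3 + j` and counting doubly (`sum_insideCount_choose_add`) expresses the binomial moments of
the numbers of enclosed points by those of the numbers of points to the left of directed edges. An
edge and its reverse have left counts with sum `n - 2`, so the second and third binomial moments
need only the sum of the products of these two counts. Comparing convex and nonconvex quadruples
expresses that sum by the crossing number (`sum_leftCount_mul_add`). The value at `-1` follows from
`(-1) ^ l = (1 - 2) ^ l`, which combines all the moments; for odd `n` the signs of an edge and its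
reverse cancel. -/

/-! ### Lines separating the origin from a finite planar set -/

section LocalPicture

variable {ι : Type*}

/-- The cross product of the plane vectors `(x i, y i)` and `(x j, y j)`. -/
def crossAt (x y : ι → ℝ) (i j : ι) : ℝ := x i * y j - x j * y i

/-- Twice the signed area of the triangle with vertices `(x i, y i)`, `(x j, y j)`, `(x k, y k)`. -/
def areaAt (x y : ι → ℝ) (i j k : ι) : ℝ :=
  crossAt x y i j + crossAt x y j k + crossAt x y k i

/-- The line through the points `i` and `j` separates the origin from all other points of `I`. -/
def SeparatesOrigin (I : Finset ι) (x y : ι → ℝ) (i j : ι) : Prop :=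
  ∀ k ∈ I, k ≠ i → k ≠ j → areaAt x y i j k * crossAt x y i j < 0

/-- All points of `I` other than `a` are strictly to the left of the ray from the origin
through `a`. -/
def IsFirstRay (I : Finset ι) (x y : ι → ℝ) (a : ι) : Prop :=
  ∀ k ∈ I, k ≠ a → 0 < crossAt x y a k

/-- The line through `i` and `j` meets the axis `x = 0` at height `-crossAt x y i j / (x j - x i)`.
The right side is thus `(x j - x i) * (x l - x k)` times the height of `kl` minus the height of
`ij`: the identity compares heights by means of signed areas. -/
lemma area_crossing_identity (x y : ι → ℝ) (i j k l : ι) :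
    x l * areaAt x y i j k - x k * areaAt x y i j l =
      crossAt x y i j * (x l - x k) - crossAt x y k l * (x j - x i) := by
  simp only [areaAt, crossAt]; ring

lemma areaAt_right (x y : ι → ℝ) (i j : ι) : areaAt x y i j j = 0 := by
  simp only [areaAt, crossAt]; ring

lemma areaAt_left (x y : ι → ℝ) (i j : ι) : areaAt x y i j i = 0 := by
  simp only [areaAt, crossAt]; ring

lemma SeparatesOrigin.area_nonneg {I : Finset ι} {x y : ι → ℝ} {i j k : ι}
    (h : SeparatesOrigin I x y i j) (hc : crossAt x y i j < 0) (hk : k ∈ I) :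
    0 ≤ areaAt x y i j k := by
  by_cases hki : k = i
  · rw [hki, areaAt_left]
  by_cases hkj : k = j
  · rw [hkj, areaAt_right]
  have := h k hk hki hkj
  nlinarith

lemma SeparatesOrigin.area_pos {I : Finset ι} {x y : ι → ℝ} {i j k : ι}
    (h : SeparatesOrigin I x y i j) (hc : crossAt x y i j < 0) (hk : k ∈ I)
    (hki : k ≠ i) (hkj : k ≠ j) : 0 < areaAt x y i j k := by
  have := h k hk hki hkj
  nlinarith

/-- A negative cross product of a left and a right point means that their segment meets the axis
above the origin. The segment `kl` lies on or beyond the separating line `ij`, so it meets the axis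
no lower than `ij` does. -/
lemma SeparatesOrigin.cross_neg {I : Finset ι} {x y : ι → ℝ} {i j k l : ι}
    (h : SeparatesOrigin I x y i j) (hi : x i < 0) (hj : 0 < x j) (hc : crossAt x y i j < 0)
    (hk : k ∈ I) (hl : l ∈ I) (hxk : x k < 0) (hxl : 0 < x l) : crossAt x y k l < 0 := by
  have h1 := mul_nonneg hxl.le (h.area_nonneg hc hk)
  have h2 := mul_nonneg (neg_nonneg.2 hxk.le) (h.area_nonneg hc hl)
  have h3 := area_crossing_identity x y i j k l
  have h4 : crossAt x y i j * (x l - x k) < 0 := mul_neg_of_neg_of_pos hc (by linarith)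
  by_contra! h5
  have h6 : 0 ≤ crossAt x y k l * (x j - x i) := mul_nonneg h5 (by linarith)
  linarith

/-- Both lines attain the minimal height on the axis, so the heights agree. A point of one pair
outside the other would lie strictly beyond the other line and make one of the inequalities strict.
-/
lemma SeparatesOrigin.eq_of_cross_neg {I : Finset ι} {x y : ι → ℝ} {i j k l : ι}
    (h : SeparatesOrigin I x y i j) (hi : x i < 0) (hj : 0 < x j) (hc : crossAt x y i j < 0)
    (hiI : i ∈ I) (hjI : j ∈ I)
    (h' : SeparatesOrigin I x y k l) (hk : k ∈ I) (hl : l ∈ I) (hxk : x k < 0) (hxl : 0 < x l) :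
    i = k ∧ j = l := by
  have hc' := h.cross_neg hi hj hc hk hl hxk hxl
  have h1 := mul_nonneg hxl.le (h.area_nonneg hc hk)
  have h2 := mul_nonneg (neg_nonneg.2 hxk.le) (h.area_nonneg hc hl)
  have h3 := area_crossing_identity x y i j k l
  have h1' := mul_nonneg hj.le (h'.area_nonneg hc' hiI)
  have h2' := mul_nonneg (neg_nonneg.2 hi.le) (h'.area_nonneg hc' hjI)
  have h3' := area_crossing_identity x y k l i j
  constructor
  · by_contra hne
    have : k ≠ j := by rintro rfl; linarith
    have := mul_pos hxl (h.area_pos hc hk (Ne.symm hne) this)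
    linarith
  · by_contra hne
    have : l ≠ i := by rintro rfl; linarith
    have := mul_pos (neg_pos.2 hxk) (h.area_pos hc hl this (Ne.symm hne))
    linarith

lemma exists_separatesOrigin {I : Finset ι} {x y : ι → ℝ} (hx : ∀ i ∈ I, x i ≠ 0)
    (hD : ∀ i ∈ I, ∀ j ∈ I, ∀ k ∈ I, i ≠ j → k ≠ i → k ≠ j → areaAt x y i j k ≠ 0)
    (hL : ∃ i ∈ I, x i < 0) (hR : ∃ j ∈ I, 0 < x j)
    (hneg : ∀ i ∈ I, ∀ j ∈ I, x i < 0 → 0 < x j → crossAt x y i j < 0) :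
    ∃ i ∈ I, ∃ j ∈ I, x i < 0 ∧ 0 < x j ∧ SeparatesOrigin I x y i j := by
  obtain ⟨i₀, hi₀, hxi₀⟩ := hL
  obtain ⟨j₀, hj₀, hxj₀⟩ := hR
  -- The minimized quantity is the height at which the segment crosses the axis. The minimizer is
  -- the hull edge facing the origin.
  obtain ⟨⟨i, j⟩, hij, hmin⟩ := ((I ×ˢ I).filter fun e => x e.1 < 0 ∧ 0 < x e.2).exists_min_image
    (fun e => -crossAt x y e.1 e.2 / (x e.2 - x e.1)) ⟨(i₀, j₀), by simp [*]⟩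
  simp only [Finset.mem_filter, Finset.mem_product, Prod.forall] at hij hmin
  obtain ⟨⟨hi, hj⟩, hxi, hxj⟩ := hij
  have key : ∀ k ∈ I, ∀ l ∈ I, x k < 0 → 0 < x l →
      0 ≤ x l * areaAt x y i j k - x k * areaAt x y i j l := by
    intro k hk l hl hxk hxl
    have := hmin k l ⟨⟨hk, hl⟩, hxk, hxl⟩
    rw [div_le_div_iff₀ (by linarith) (by linarith)] at this
    rw [area_crossing_identity]
    linarith
  refine ⟨i, hi, j, hj, hxi, hxj, fun k hk hki hkj => ?_⟩
  have hc := hneg i hi j hj hxi hxj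
  have hne := hD i hi j hj k hk (by rintro rfl; linarith) hki hkj
  refine mul_neg_of_pos_of_neg (lt_of_le_of_ne ?_ hne.symm) hc
  rcases lt_or_gt_of_ne (hx k hk) with hxk | hxk
  · have := key k hk j hj hxk hxj
    rw [areaAt_right] at this
    by_contra! h
    nlinarith
  · have := key i hi k hk hxi hxk
    rw [areaAt_left] at this
    by_contra! h
    nlinarith

lemma crossAt_neg_y (x y : ι → ℝ) (i j : ι) : crossAt x (-y) i j = -crossAt x y i j := by
  simp [crossAt]; ring

lemma crossAt_neg_neg (x y : ι → ℝ) (i j : ι) : crossAt (-x) (-y) i j = crossAt x y i j := by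
  simp [crossAt]

lemma crossAt_swap (x y : ι → ℝ) (i j : ι) : crossAt x y i j = -crossAt x y j i := by
  simp [crossAt]

lemma crossAt_self (x y : ι → ℝ) (i : ι) : crossAt x y i i = 0 := by
  simp [crossAt]

lemma areaAt_neg_y (x y : ι → ℝ) (i j k : ι) : areaAt x (-y) i j k = -areaAt x y i j k := by
  simp only [areaAt, crossAt_neg_y]; ring

lemma separatesOrigin_neg_y {I : Finset ι} {x y : ι → ℝ} {i j : ι} :
    SeparatesOrigin I x (-y) i j ↔ SeparatesOrigin I x y i j := by
  simp [SeparatesOrigin, crossAt_neg_y, areaAt_neg_y]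

lemma isFirstRay_neg_neg {I : Finset ι} {x y : ι → ℝ} {a : ι} :
    IsFirstRay I (-x) (-y) a ↔ IsFirstRay I x y a := by
  simp [IsFirstRay, crossAt_neg_neg]

lemma IsFirstRay.eq {I : Finset ι} {x y : ι → ℝ} {a b : ι} (ha : IsFirstRay I x y a)
    (hb : IsFirstRay I x y b) (haI : a ∈ I) (hbI : b ∈ I) : a = b := by
  by_contra h
  have h1 := ha b hbI (Ne.symm h)
  have h2 := hb a haI h
  rw [crossAt_swap] at h2
  linarith

/-- The right point of smallest slope works: other right points have larger slope, and `hneg` puts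
every left point on the left of its ray. -/
lemma exists_isFirstRay {I : Finset ι} {x y : ι → ℝ} (hx : ∀ i ∈ I, x i ≠ 0)
    (hc : ∀ i ∈ I, ∀ j ∈ I, i ≠ j → crossAt x y i j ≠ 0) (hR : ∃ j ∈ I, 0 < x j)
    (hneg : ∀ i ∈ I, ∀ j ∈ I, x i < 0 → 0 < x j → crossAt x y i j < 0) :
    ∃ a ∈ I, IsFirstRay I x y a := by
  obtain ⟨j₀, hj₀, hxj₀⟩ := hR
  obtain ⟨a, ha, hmin⟩ := (I.filter fun j => 0 < x j).exists_min_image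
    (fun j => y j / x j) ⟨j₀, by simp [*]⟩
  simp only [Finset.mem_filter] at ha hmin
  refine ⟨a, ha.1, fun k hk hka => ?_⟩
  rcases lt_or_gt_of_ne (hx k hk) with hxk | hxk
  · have := hneg k hk a ha.1 hxk ha.2
    rw [crossAt_swap]
    linarith
  · have := hmin k ⟨hk, hxk⟩
    rw [div_le_div_iff₀ ha.2 hxk] at this
    refine lt_of_le_of_ne ?_ (hc a ha.1 k hk (Ne.symm hka)).symm
    simp only [crossAt]
    linarith

/-- All points lie in the closed half-plane above the line through the origin and `a`, and a left
point lies strictly above it. Hence left-right segments meet the axis above the origin. -/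
lemma IsFirstRay.cross_neg {I : Finset ι} {x y : ι → ℝ} {a k l : ι} (ha : IsFirstRay I x y a)
    (hxa : 0 < x a) (hk : k ∈ I) (hl : l ∈ I) (hxk : x k < 0) (hxl : 0 < x l) :
    crossAt x y k l < 0 := by
  have h1 : 0 < crossAt x y a k := ha k hk (by rintro rfl; linarith)
  have h2 : 0 ≤ crossAt x y a l := by
    by_cases hla : l = a
    · rw [hla, crossAt_self]
    · exact (ha l hl hla).le
  have h3 : x a * crossAt x y k l = x k * crossAt x y a l - x l * crossAt x y a k := by
    simp only [crossAt]; ring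
  have h4 : x k * crossAt x y a l ≤ 0 := mul_nonpos_of_nonpos_of_nonneg hxk.le h2
  have h5 := mul_pos hxl h1
  by_contra! h6
  have := mul_nonneg hxa.le h6
  linarith

/-- Seen from a point with other points on both sides of the vertical line through it, there is a
separating line crossing that vertical line exactly if the point has an outgoing hull edge. -/
lemma exists_separatesOrigin_iff {I : Finset ι} {x y : ι → ℝ} (hx : ∀ i ∈ I, x i ≠ 0)
    (hc : ∀ i ∈ I, ∀ j ∈ I, i ≠ j → crossAt x y i j ≠ 0)
    (hD : ∀ i ∈ I, ∀ j ∈ I, ∀ k ∈ I, i ≠ j → k ≠ i → k ≠ j → areaAt x y i j k ≠ 0)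
    (hL : ∃ i ∈ I, x i < 0) (hR : ∃ j ∈ I, 0 < x j) :
    (∃ i ∈ I, ∃ j ∈ I, x i < 0 ∧ 0 < x j ∧ SeparatesOrigin I x y i j) ↔
      ∃ a ∈ I, IsFirstRay I x y a := by
  -- Reflecting `y` preserves separating lines and a half-turn preserves first rays, so the cases in
  -- which the segments cross below the origin reduce to those in which they cross above.
  have hx' : ∀ i ∈ I, (-x) i ≠ 0 := fun i hi => by simpa using hx i hi
  constructor
  · rintro ⟨i, hi, j, hj, hxi, hxj, h⟩
    rcases lt_or_gt_of_ne (hc i hi j hj (by rintro rfl; linarith)) with hneg | hpos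
    · exact exists_isFirstRay hx hc hR fun k hk l hl hxk hxl =>
        h.cross_neg hxi hxj hneg hk hl hxk hxl
    · obtain ⟨a, ha, h'⟩ := exists_isFirstRay (I := I) (x := -x) (y := -y) hx'
        (fun i hi j hj hij => by rw [crossAt_neg_neg]; exact hc i hi j hj hij)
        (by simpa using hL) (fun k hk l hl hxk hxl => by
          have := (separatesOrigin_neg_y.2 h).cross_neg hxi hxj
            (by rw [crossAt_neg_y]; linarith) hl hk (by simpa using hxl) (by simpa using hxk)
          rw [crossAt_neg_y, crossAt_swap] at this
          rw [crossAt_neg_neg]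
          linarith)
      exact ⟨a, ha, isFirstRay_neg_neg.1 h'⟩
  · rintro ⟨a, ha, h⟩
    rcases lt_or_gt_of_ne (hx a ha) with hxa | hxa
    · obtain ⟨i, hi, j, hj, hxi, hxj, h'⟩ := exists_separatesOrigin (I := I) (x := x) (y := -y) hx
        (fun i hi j hj k hk h1 h2 h3 => by
          rw [areaAt_neg_y]; exact neg_ne_zero.2 (hD i hi j hj k hk h1 h2 h3)) hL hR
        (fun k hk l hl hxk hxl => by
          have := (isFirstRay_neg_neg.2 h).cross_neg (by simpa using hxa) hl hk
            (by simpa using hxl) (by simpa using hxk)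
          rw [crossAt_neg_neg, crossAt_swap] at this
          rw [crossAt_neg_y]
          exact this)
      exact ⟨i, hi, j, hj, hxi, hxj, separatesOrigin_neg_y.1 h'⟩
    · exact exists_separatesOrigin hx hD hL hR fun k hk l hl hxk hxl =>
        h.cross_neg hxa hk hl hxk hxl

lemma SeparatesOrigin.eq {I : Finset ι} {x y : ι → ℝ} {i j k l : ι}
    (hc : ∀ i ∈ I, ∀ j ∈ I, i ≠ j → crossAt x y i j ≠ 0)
    (h : SeparatesOrigin I x y i j) (hi : x i < 0) (hj : 0 < x j) (hiI : i ∈ I) (hjI : j ∈ I)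
    (h' : SeparatesOrigin I x y k l) (hk : k ∈ I) (hl : l ∈ I) (hxk : x k < 0) (hxl : 0 < x l) :
    i = k ∧ j = l := by
  rcases lt_or_gt_of_ne (hc i hiI j hjI (by rintro rfl; linarith)) with hneg | hpos
  · exact h.eq_of_cross_neg hi hj hneg hiI hjI h' hk hl hxk hxl
  · exact (separatesOrigin_neg_y.2 h).eq_of_cross_neg hi hj (by rw [crossAt_neg_y]; linarith)
      hiI hjI (separatesOrigin_neg_y.2 h') hk hl hxk hxl

-- Each count is at most one by uniqueness, and they are positive together by
-- `exists_separatesOrigin_iff`.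
open Classical in
lemma card_separatesOrigin_eq {I : Finset ι} {x y : ι → ℝ} (hx : ∀ i ∈ I, x i ≠ 0)
    (hc : ∀ i ∈ I, ∀ j ∈ I, i ≠ j → crossAt x y i j ≠ 0)
    (hD : ∀ i ∈ I, ∀ j ∈ I, ∀ k ∈ I, i ≠ j → k ≠ i → k ≠ j → areaAt x y i j k ≠ 0)
    (hL : ∃ i ∈ I, x i < 0) (hR : ∃ j ∈ I, 0 < x j) :
    ((I ×ˢ I).filter fun e => x e.1 < 0 ∧ 0 < x e.2 ∧ SeparatesOrigin I x y e.1 e.2).card =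
      (I.filter fun a => IsFirstRay I x y a).card := by
  have h1 : ((I ×ˢ I).filter
      fun e => x e.1 < 0 ∧ 0 < x e.2 ∧ SeparatesOrigin I x y e.1 e.2).card ≤ 1 := by
    rw [Finset.card_le_one]
    rintro ⟨i, j⟩ h ⟨k, l⟩ h'
    simp only [Finset.mem_filter, Finset.mem_product] at h h'
    obtain ⟨rfl, rfl⟩ := h.2.2.2.eq hc h.2.1 h.2.2.1 h.1.1 h.1.2 h'.2.2.2 h'.1.1 h'.1.2 h'.2.1
      h'.2.2.1
    rfl
  have h2 : (I.filter fun a => IsFirstRay I x y a).card ≤ 1 := by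
    rw [Finset.card_le_one]
    intro a h b h'
    simp only [Finset.mem_filter] at h h'
    exact h.2.eq h'.2 h.1 h'.1
  have h3 : 0 < ((I ×ˢ I).filter
      fun e => x e.1 < 0 ∧ 0 < x e.2 ∧ SeparatesOrigin I x y e.1 e.2).card ↔
      0 < (I.filter fun a => IsFirstRay I x y a).card := by
    have := exists_separatesOrigin_iff hx hc hD hL hR
    rw [Finset.card_pos, Finset.card_pos, Finset.filter_nonempty_iff, Finset.filter_nonempty_iff,
      ← this]
    simp only [Finset.mem_product, Prod.exists]
    constructor
    · rintro ⟨i, j, ⟨hi, hj⟩, h⟩; exact ⟨i, hi, j, hj, h⟩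
    · rintro ⟨i, hi, j, hj, h⟩; exact ⟨i, j, ⟨hi, hj⟩, h⟩
  omega

open Classical in
lemma card_isFirstRay_eq_one {I : Finset ι} {x y : ι → ℝ} (hI : I.Nonempty)
    (hc : ∀ i ∈ I, ∀ j ∈ I, i ≠ j → crossAt x y i j ≠ 0)
    (hx : (∀ i ∈ I, 0 < x i) ∨ ∀ i ∈ I, x i < 0) :
    (I.filter fun a => IsFirstRay I x y a).card = 1 := by
  have h2 : (I.filter fun a => IsFirstRay I x y a).card ≤ 1 := by
    rw [Finset.card_le_one]
    intro a h b h'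
    simp only [Finset.mem_filter] at h h'
    exact h.2.eq h'.2 h.1 h'.1
  refine le_antisymm h2 (Finset.card_pos.2 ?_)
  rw [Finset.filter_nonempty_iff]
  obtain ⟨j, hj⟩ := hI
  rcases hx with hx | hx
  · exact exists_isFirstRay (fun i hi => (hx i hi).ne') hc ⟨j, hj, hx j hj⟩
      fun i hi _ _ h => absurd (hx i hi) h.le.not_gt
  · obtain ⟨a, ha, h⟩ := exists_isFirstRay (I := I) (x := -x) (y := -y)
      (fun i hi => by simpa using (hx i hi).ne)
      (fun i hi j hj hij => by rw [crossAt_neg_neg]; exact hc i hi j hj hij)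
      ⟨j, hj, by simpa using hx j hj⟩
      fun i hi _ _ h => absurd (hx i hi) (by simpa using h.le)
    exact ⟨a, ha, isFirstRay_neg_neg.1 h⟩

end LocalPicture

lemma mul_neg_iff_right_of_pos {a b : ℝ} (ha : 0 < a) : a * b < 0 ↔ b < 0 := by
  rw [← not_le, ← not_le, mul_nonneg_iff_of_pos_left ha]

/-! ### Circles, the in-circle determinant and inversion -/

section PlaneGeometry

/-- Twice the signed area of the triangle `a b c`. -/
def orient (a b c : Plane) : ℝ := (b 0 - a 0) * (c 1 - a 1) - (b 1 - a 1) * (c 0 - a 0)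

/-- The squared distance of two points of the plane. -/
def sqDist (a b : Plane) : ℝ := (a 0 - b 0) ^ 2 + (a 1 - b 1) ^ 2

/-- The in-circle determinant of four points of the plane. -/
def inCircleDet (v a b d : Plane) : ℝ :=
  sqDist d v * orient v a b + sqDist a v * orient v b d - sqDist b v * orient v a d

/-- Some circle through the points of `T` contains `d` strictly inside. -/
def Encloses (T : Finset Plane) (d : Plane) : Prop :=
  ∃ C : EuclideanGeometry.Sphere Plane, (∀ p ∈ T, p ∈ C) ∧ dist d C.center < C.radius

lemma dist_sq_eq_sqDist (a b : Plane) : dist a b ^ 2 = sqDist a b := by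
  rw [EuclideanSpace.dist_eq, Real.sq_sqrt (by positivity)]
  simp [Real.dist_eq, sqDist, sq_abs]

lemma sqDist_pos {a b : Plane} (h : a ≠ b) : 0 < sqDist a b := by
  rw [← dist_sq_eq_sqDist]
  exact pow_pos (dist_pos.2 h) 2

lemma radius_sq_of_mem {C : EuclideanGeometry.Sphere Plane} {p : Plane} (h : p ∈ C) :
    sqDist p C.center = C.radius ^ 2 := by
  rw [← dist_sq_eq_sqDist, EuclideanGeometry.mem_sphere.1 h]

lemma radius_nonneg_of_mem {C : EuclideanGeometry.Sphere Plane} {p : Plane} (h : p ∈ C) :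
    0 ≤ C.radius := by
  rw [← EuclideanGeometry.mem_sphere.1 h]
  exact dist_nonneg

/-- The power of `d` with respect to the circle is `sqDist d v` plus an affine function of `d`, and
this function is fixed by the vanishing of the power at `v`, `a` and `b`. -/
lemma power_mul_orient {C : EuclideanGeometry.Sphere Plane} {v a b : Plane} (hv : v ∈ C)
    (ha : a ∈ C) (hb : b ∈ C) (d : Plane) :
    (sqDist d C.center - C.radius ^ 2) * orient v a b = inCircleDet v a b d := by
  have h1 := radius_sq_of_mem hv
  have h2 := radius_sq_of_mem ha
  have h3 := radius_sq_of_mem hb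
  simp only [sqDist, orient, inCircleDet] at *
  linear_combination
    (((a 0 - v 0) * (b 1 - v 1) - (a 1 - v 1) * (b 0 - v 0)) +
      ((b 0 - v 0) * (d 1 - v 1) - (b 1 - v 1) * (d 0 - v 0)) -
      ((a 0 - v 0) * (d 1 - v 1) - (a 1 - v 1) * (d 0 - v 0))) * h1 -
    ((b 0 - v 0) * (d 1 - v 1) - (b 1 - v 1) * (d 0 - v 0)) * h2 +
    ((a 0 - v 0) * (d 1 - v 1) - (a 1 - v 1) * (d 0 - v 0)) * h3

lemma mem_iff_inCircleDet_eq_zero {C : EuclideanGeometry.Sphere Plane} {v a b : Plane}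
    (hv : v ∈ C) (ha : a ∈ C) (hb : b ∈ C) (ho : orient v a b ≠ 0) (d : Plane) :
    d ∈ C ↔ inCircleDet v a b d = 0 := by
  rw [← power_mul_orient hv ha hb, mul_eq_zero_iff_right ho, sub_eq_zero, ← dist_sq_eq_sqDist,
    sq_eq_sq₀ dist_nonneg (radius_nonneg_of_mem hv), EuclideanGeometry.mem_sphere]

lemma inside_iff_inCircleDet {C : EuclideanGeometry.Sphere Plane} {v a b : Plane}
    (hv : v ∈ C) (ha : a ∈ C) (hb : b ∈ C) (ho : orient v a b ≠ 0) (d : Plane) :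
    dist d C.center < C.radius ↔ inCircleDet v a b d * orient v a b < 0 := by
  rw [← power_mul_orient hv ha hb, ← sq_lt_sq₀ dist_nonneg (radius_nonneg_of_mem hv),
    dist_sq_eq_sqDist, mul_assoc, mul_comm,
    mul_neg_iff_right_of_pos (mul_self_pos.2 ho), sub_neg]

lemma exists_circle {v a b : Plane} (ho : orient v a b ≠ 0) :
    ∃ C : EuclideanGeometry.Sphere Plane, v ∈ C ∧ a ∈ C ∧ b ∈ C := by
  -- Cramer's rule for the circumcenter, from `2 (a - v)·(c - v) = |a - v|²` and `2 (b - v)·(c - v)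
  -- = |b - v|²`.
  let c : Plane := !₂[v 0 + (sqDist a v * (b 1 - v 1) - sqDist b v * (a 1 - v 1)) /
      (2 * orient v a b),
    v 1 + (sqDist b v * (a 0 - v 0) - sqDist a v * (b 0 - v 0)) / (2 * orient v a b)]
  have h0 : 2 * orient v a b * (c 0 - v 0) =
      sqDist a v * (b 1 - v 1) - sqDist b v * (a 1 - v 1) := by
    simp only [c, Matrix.cons_val_zero]
    field_simp
    ring
  have h1 : 2 * orient v a b * (c 1 - v 1) =
      sqDist b v * (a 0 - v 0) - sqDist a v * (b 0 - v 0) := by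
    simp only [c, Matrix.cons_val_one, Matrix.cons_val_zero]
    field_simp
    ring
  refine ⟨⟨c, dist v c⟩, EuclideanGeometry.mem_sphere.2 rfl, EuclideanGeometry.mem_sphere.2 ?_,
    EuclideanGeometry.mem_sphere.2 ?_⟩
  · change dist a c = dist v c
    rw [← sq_eq_sq₀ dist_nonneg dist_nonneg, dist_sq_eq_sqDist, dist_sq_eq_sqDist]
    refine mul_left_cancel₀ ho ?_
    simp only [orient, sqDist] at *
    linear_combination -(a 0 - v 0) * h0 - (a 1 - v 1) * h1
  · change dist b c = dist v c
    rw [← sq_eq_sq₀ dist_nonneg dist_nonneg, dist_sq_eq_sqDist, dist_sq_eq_sqDist]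
    refine mul_left_cancel₀ ho ?_
    simp only [orient, sqDist] at *
    linear_combination -(b 0 - v 0) * h0 - (b 1 - v 1) * h1

lemma circle_unique {C C' : EuclideanGeometry.Sphere Plane} {v a b : Plane}
    (ho : orient v a b ≠ 0) (hv : v ∈ C) (ha : a ∈ C) (hb : b ∈ C)
    (hv' : v ∈ C') (ha' : a ∈ C') (hb' : b ∈ C') : C = C' := by
  have h1 := radius_sq_of_mem hv
  have h2 := radius_sq_of_mem ha
  have h3 := radius_sq_of_mem hb
  have h1' := radius_sq_of_mem hv'
  have h2' := radius_sq_of_mem ha'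
  have h3' := radius_sq_of_mem hb'
  have hc : C.center = C'.center := by
    ext i
    refine mul_left_cancel₀ ho ?_
    simp only [orient, sqDist] at *
    fin_cases i
    · simp only [Fin.zero_eta]
      linear_combination (-(b 1 - v 1) * (h2 - h1 - h2' + h1') +
        (a 1 - v 1) * (h3 - h1 - h3' + h1')) / 2
    · simp only [Fin.mk_one]
      linear_combination ((b 0 - v 0) * (h2 - h1 - h2' + h1') -
        (a 0 - v 0) * (h3 - h1 - h3' + h1')) / 2
  refine EuclideanGeometry.Sphere.ext hc ?_
  rw [← EuclideanGeometry.mem_sphere.1 hv, ← EuclideanGeometry.mem_sphere.1 hv', hc]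

lemma encloses_iff {v a b : Plane} (ho : orient v a b ≠ 0) (d : Plane) :
    Encloses {v, a, b} d ↔ inCircleDet v a b d * orient v a b < 0 := by
  constructor
  · rintro ⟨C, hC, hd⟩
    exact (inside_iff_inCircleDet (hC v (by simp)) (hC a (by simp)) (hC b (by simp)) ho d).1 hd
  · intro h
    obtain ⟨C, hv, ha, hb⟩ := exists_circle ho
    exact ⟨C, by simp [hv, ha, hb], (inside_iff_inCircleDet hv ha hb ho d).2 h⟩

lemma collinear_of_orient_eq_zero {a b c : Plane} (hab : a ≠ b) (h : orient a b c = 0) :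
    Collinear ℝ ({a, b, c} : Set Plane) := by
  rw [collinear_iff_of_mem (p₀ := a) (by simp)]
  have hq := (sqDist_pos hab.symm).ne'
  refine ⟨b - a, ?_⟩
  rintro p (rfl | rfl | rfl)
  · exact ⟨0, by simp⟩
  · exact ⟨1, by simp⟩
  · refine ⟨((p 0 - a 0) * (b 0 - a 0) + (p 1 - a 1) * (b 1 - a 1)) / sqDist b a, ?_⟩
    ext i
    refine mul_left_cancel₀ hq ?_
    have : sqDist b a * (((p 0 - a 0) * (b 0 - a 0) + (p 1 - a 1) * (b 1 - a 1)) / sqDist b a) =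
      (p 0 - a 0) * (b 0 - a 0) + (p 1 - a 1) * (b 1 - a 1) := by field_simp
    simp only [vadd_eq_add, PiLp.add_apply, PiLp.smul_apply, PiLp.sub_apply, smul_eq_mul, mul_add,
      ← mul_assoc, this]
    simp only [orient, sqDist] at *
    fin_cases i
    · simp only [Fin.zero_eta]
      linear_combination -(b 1 - a 1) * h
    · simp only [Fin.mk_one]
      linear_combination (b 0 - a 0) * h

lemma InGeneralPosition.orient_ne_zero {S : Finset Plane} (hS : InGeneralPosition S)
    {a b c : Plane} (ha : a ∈ S) (hb : b ∈ S) (hc : c ∈ S) (hab : a ≠ b) (hac : a ≠ c)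
    (hbc : b ≠ c) : orient a b c ≠ 0 := by
  classical
  intro h
  refine hS.1 {a, b, c} (by simp [Finset.insert_subset_iff, *])
    (Finset.card_eq_three.2 ⟨a, b, c, hab, hac, hbc, rfl⟩) ?_
  simpa using collinear_of_orient_eq_zero hab h

lemma InGeneralPosition.inCircleDet_ne_zero {S : Finset Plane} (hS : InGeneralPosition S)
    {v a b d : Plane} (hv : v ∈ S) (ha : a ∈ S) (hb : b ∈ S) (hd : d ∈ S) (hva : v ≠ a)
    (hvb : v ≠ b) (hvd : v ≠ d) (hab : a ≠ b) (had : a ≠ d) (hbd : b ≠ d) :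
    inCircleDet v a b d ≠ 0 := by
  classical
  intro h
  have ho := hS.orient_ne_zero hv ha hb hva hvb hab
  obtain ⟨C, hvC, haC, hbC⟩ := exists_circle ho
  have hdC := (mem_iff_inCircleDet_eq_zero hvC haC hbC ho d).2 h
  refine hS.2 {v, a, b, d} (by simp [Finset.insert_subset_iff, *])
    (by simp [Finset.card_insert_of_notMem, *]) ⟨C.center, C.radius, ?_⟩
  simp only [Finset.coe_insert, Finset.coe_singleton, Set.mem_insert_iff, Set.mem_singleton_iff,
    forall_eq_or_imp, forall_eq]
  exact ⟨hvC, haC, hbC, hdC⟩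

lemma InGeneralPosition.mono {S Q : Finset Plane} (hS : InGeneralPosition S) (hQ : Q ⊆ S) :
    InGeneralPosition Q :=
  ⟨fun T hT => hS.1 T (hT.trans hQ), fun T hT => hS.2 T (hT.trans hQ)⟩

/-- The linear functional `p ↦ p 0 + t * p 1`. -/
def tilt (t : ℝ) (p : Plane) : ℝ := p 0 + t * p 1

/-- First coordinate of the image of `p` under inversion at `v` (in a rotated frame). -/
noncomputable def invX (t : ℝ) (v p : Plane) : ℝ := (tilt t p - tilt t v) / sqDist p v

/-- Second coordinate of the image of `p` under inversion at `v` (in a rotated frame). -/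
noncomputable def invY (t : ℝ) (v p : Plane) : ℝ :=
  ((p 1 - v 1) - t * (p 0 - v 0)) / sqDist p v

/-- Inversion at `v` keeps the rays from `v`, so only positive factors appear. The frame `(1, t)`,
`(-t, 1)` is orthogonal but not normalized, whence `1 + t ^ 2`. -/
lemma crossAt_inv (t : ℝ) {v a b : Plane} (ha : a ≠ v) (hb : b ≠ v) :
    crossAt (invX t v) (invY t v) a b =
      (1 + t ^ 2) / (sqDist a v * sqDist b v) * orient v a b := by
  have h1 := (sqDist_pos ha).ne'
  have h2 := (sqDist_pos hb).ne'
  simp only [crossAt, invX, invY, orient, tilt]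
  field_simp
  ring

lemma areaAt_inv (t : ℝ) {v a b d : Plane} (ha : a ≠ v) (hb : b ≠ v) (hd : d ≠ v) :
    areaAt (invX t v) (invY t v) a b d =
      (1 + t ^ 2) / (sqDist a v * sqDist b v * sqDist d v) * inCircleDet v a b d := by
  have h1 := (sqDist_pos ha).ne'
  have h2 := (sqDist_pos hb).ne'
  have h3 := (sqDist_pos hd).ne'
  have h4 : orient v d a = -orient v a d := by simp only [orient]; ring
  simp only [areaAt, crossAt_inv t ha hb, crossAt_inv t hb hd, crossAt_inv t hd ha, inCircleDet, h4]
  field_simp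
  ring

lemma crossAt_inv_pos_iff (t : ℝ) {v a b : Plane} (ha : a ≠ v) (hb : b ≠ v) :
    0 < crossAt (invX t v) (invY t v) a b ↔ 0 < orient v a b := by
  have h1 := sqDist_pos ha
  have h2 := sqDist_pos hb
  rw [crossAt_inv t ha hb]
  exact mul_pos_iff_of_pos_left (by positivity)

lemma crossAt_inv_ne_zero (t : ℝ) {v a b : Plane} (ha : a ≠ v) (hb : b ≠ v)
    (h : orient v a b ≠ 0) : crossAt (invX t v) (invY t v) a b ≠ 0 := by
  have h1 := sqDist_pos ha
  have h2 := sqDist_pos hb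
  rw [crossAt_inv t ha hb]
  positivity

lemma areaAt_inv_ne_zero (t : ℝ) {v a b d : Plane} (ha : a ≠ v) (hb : b ≠ v) (hd : d ≠ v)
    (h : inCircleDet v a b d ≠ 0) : areaAt (invX t v) (invY t v) a b d ≠ 0 := by
  have h1 := sqDist_pos ha
  have h2 := sqDist_pos hb
  have h3 := sqDist_pos hd
  rw [areaAt_inv t ha hb hd]
  positivity

/-- Inversion at `v` sends the circle through `v`, `a`, `b` to the line through the images of `a`
and `b`, and its interior to the open half-plane not containing the origin. -/
lemma areaAt_mul_crossAt_inv_neg_iff (t : ℝ) {v a b d : Plane} (ha : a ≠ v) (hb : b ≠ v)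
    (hd : d ≠ v) (h : orient v a b ≠ 0) :
    areaAt (invX t v) (invY t v) a b d * crossAt (invX t v) (invY t v) a b < 0 ↔
      Encloses {v, a, b} d := by
  have h1 := sqDist_pos ha
  have h2 := sqDist_pos hb
  have h3 := sqDist_pos hd
  rw [areaAt_inv t ha hb hd, crossAt_inv t ha hb, encloses_iff h, mul_mul_mul_comm]
  exact mul_neg_iff_right_of_pos (by positivity)

lemma invX_pos_iff (t : ℝ) {v p : Plane} (h : p ≠ v) : 0 < invX t v p ↔ tilt t v < tilt t p := by
  rw [invX, div_pos_iff_of_pos_right (sqDist_pos h), sub_pos]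

lemma invX_neg_iff (t : ℝ) {v p : Plane} (h : p ≠ v) : invX t v p < 0 ↔ tilt t p < tilt t v := by
  rw [invX, div_neg_iff]
  have := sqDist_pos h
  constructor
  · rintro (h | h) <;> linarith [h.1, h.2]
  · intro h; right; exact ⟨by linarith, this⟩

lemma exists_tilt_injOn (S : Finset Plane) : ∃ t : ℝ, Set.InjOn (tilt t) S := by
  classical
  -- Two points with different second coordinates share a value of `tilt t` for exactly one `t`.
  -- Pairs with equal second coordinates only contribute the harmless value `0`, since division by
  -- zero gives `0`.
  obtain ⟨t, ht⟩ := Infinite.exists_notMem_finset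
    ((S ×ˢ S).image fun e => -(e.1 0 - e.2 0) / (e.1 1 - e.2 1))
  refine ⟨t, fun p hp q hq h => ?_⟩
  simp only [Finset.mem_image, Finset.mem_product, Prod.exists, not_exists, not_and] at ht
  have h' := ht p q ⟨hp, hq⟩
  simp only [tilt] at h
  by_cases h1 : p 1 = q 1
  · ext i
    fin_cases i
    · simp only [Fin.zero_eta]; rw [h1] at h; linarith
    · exact h1
  · exfalso
    apply h'
    rw [div_eq_iff (sub_ne_zero.2 h1)]
    linarith

end PlaneGeometry

/-! ### Circles enclosing all other points versus hull edges -/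

section FarthestPoint

open Classical in
/-- The number of circles through three points of `Q` that enclose all other points of `Q`. -/
noncomputable def farthestCount (Q : Finset Plane) : ℕ :=
  ((Q.powersetCard 3).filter fun T => ∀ d ∈ Q, d ∉ T → Encloses T d).card

open Classical in
/-- The number of directed edges `ab` with all other points of `Q` on their left. -/
noncomputable def hullEdgeCount (Q : Finset Plane) : ℕ :=
  (Q.offDiag.filter fun e => ∀ c ∈ Q, c ≠ e.1 → c ≠ e.2 → 0 < orient e.1 e.2 c).card

open Classical in
/-- The number of hull edges of `Q` starting at `v`. -/
noncomputable def hullDegree (Q : Finset Plane) (t : ℝ) (v : Plane) : ℕ :=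
  ((Q.erase v).filter fun a => IsFirstRay (Q.erase v) (invX t v) (invY t v) a).card

open Classical in
/-- The pairs `(i, j)` such that `v` lies between `i` and `j` in the order given by `tilt t`, and
the circle through `v`, `i`, `j` encloses all other points of `Q`. -/
noncomputable def middlePairs (Q : Finset Plane) (t : ℝ) (v : Plane) : Finset (Plane × Plane) :=
  ((Q.erase v) ×ˢ (Q.erase v)).filter fun e => invX t v e.1 < 0 ∧ 0 < invX t v e.2 ∧
    SeparatesOrigin (Q.erase v) (invX t v) (invY t v) e.1 e.2

lemma mem_middlePairs {Q : Finset Plane} (hQ : InGeneralPosition Q) {t : ℝ} {v i j : Plane}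
    (hv : v ∈ Q) : (i, j) ∈ middlePairs Q t v ↔ i ∈ Q ∧ j ∈ Q ∧ tilt t i < tilt t v ∧
      tilt t v < tilt t j ∧ ∀ d ∈ Q, d ≠ v → d ≠ i → d ≠ j → Encloses {v, i, j} d := by
  simp only [middlePairs, Finset.mem_filter, Finset.mem_product, Finset.mem_erase]
  constructor
  · rintro ⟨⟨⟨hiv, hi⟩, hjv, hj⟩, hxi, hxj, h⟩
    rw [invX_neg_iff t hiv] at hxi
    rw [invX_pos_iff t hjv] at hxj
    refine ⟨hi, hj, hxi, hxj, fun d hd hdv hdi hdj => ?_⟩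
    have hij : i ≠ j := by rintro rfl; linarith
    exact (areaAt_mul_crossAt_inv_neg_iff t hiv hjv hdv
      (hQ.orient_ne_zero hv hi hj hiv.symm hjv.symm hij)).1
        (h d (Finset.mem_erase.2 ⟨hdv, hd⟩) hdi hdj)
  · rintro ⟨hi, hj, hxi, hxj, h⟩
    have hiv : i ≠ v := by rintro rfl; linarith
    have hjv : j ≠ v := by rintro rfl; linarith
    have hij : i ≠ j := by rintro rfl; linarith
    refine ⟨⟨⟨hiv, hi⟩, hjv, hj⟩, (invX_neg_iff t hiv).2 hxi, (invX_pos_iff t hjv).2 hxj,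
      fun d hd hdi hdj => ?_⟩
    obtain ⟨hdv, hd⟩ := Finset.mem_erase.1 hd
    exact (areaAt_mul_crossAt_inv_neg_iff t hiv hjv hdv
      (hQ.orient_ne_zero hv hi hj hiv.symm hjv.symm hij)).2 (h d hd hdv hdi hdj)

/-- Hull edges are grouped by starting point. Since inversion keeps the orientation seen from `v`,
the first ray condition on the images is the hull edge condition, for every `t`. -/
lemma hullEdgeCount_eq_sum (Q : Finset Plane) (t : ℝ) :
    hullEdgeCount Q = ∑ v ∈ Q, hullDegree Q t v := by
  classical
  rw [hullEdgeCount, Finset.card_eq_sum_card_fiberwise (f := Prod.fst) (t := Q)]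
  · refine Finset.sum_congr rfl fun v hv => ?_
    rw [hullDegree]
    have key : ∀ a, a ≠ v → (IsFirstRay (Q.erase v) (invX t v) (invY t v) a ↔
        ∀ c ∈ Q, c ≠ v → c ≠ a → 0 < orient v a c) := by
      intro a ha
      constructor
      · intro h c hc hcv hca
        exact (crossAt_inv_pos_iff t ha hcv).1 (h c (Finset.mem_erase.2 ⟨hcv, hc⟩) hca)
      · intro h c hc hca
        obtain ⟨hcv, hc⟩ := Finset.mem_erase.1 hc
        exact (crossAt_inv_pos_iff t ha hcv).2 (h c hc hcv hca)
    refine Finset.card_nbij' Prod.snd (fun a => (v, a)) ?_ ?_ ?_ ?_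
    · rintro ⟨w, a⟩ h
      simp only [Finset.coe_filter, Finset.mem_filter, Finset.mem_offDiag, Set.mem_ofPred_eq] at h
      obtain ⟨⟨⟨-, ha, hne⟩, h⟩, rfl⟩ := h
      simp only [Finset.coe_filter, Set.mem_ofPred_eq, Finset.mem_erase]
      exact ⟨⟨hne.symm, ha⟩, (key a hne.symm).2 h⟩
    · intro a h
      simp only [Finset.coe_filter, Set.mem_ofPred_eq, Finset.mem_erase] at h
      simp only [Finset.coe_filter, Finset.mem_filter, Finset.mem_offDiag, Set.mem_ofPred_eq]
      exact ⟨⟨⟨hv, h.1.2, h.1.1.symm⟩, (key a h.1.1).1 h.2⟩, trivial⟩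
    · rintro ⟨w, a⟩ h
      simp only [Finset.coe_filter, Finset.mem_filter, Set.mem_ofPred_eq] at h
      rw [← h.2]
    · intro a _
      rfl
  · rintro ⟨w, a⟩ h
    simp only [Finset.coe_filter, Finset.mem_offDiag, Set.mem_ofPred_eq] at h
    exact h.1.1

lemma exists_sorted_triple {f : Plane → ℝ} {T : Finset Plane} (hT : T.card = 3)
    (hf : Set.InjOn f T) : ∃ v i j, T = {v, i, j} ∧ f i < f v ∧ f v < f j := by
  classical
  obtain ⟨a, b, c, hab, hac, hbc, rfl⟩ := Finset.card_eq_three.1 hT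
  have h1 := hf.ne (by simp) (by simp) hab
  have h2 := hf.ne (by simp) (by simp) hac
  have h3 := hf.ne (by simp) (by simp) hbc
  rcases lt_or_gt_of_ne h1 with h1 | h1 <;> rcases lt_or_gt_of_ne h2 with h2 | h2 <;>
    rcases lt_or_gt_of_ne h3 with h3 | h3
  · exact ⟨b, a, c, by ext; simp; tauto, h1, h3⟩
  · exact ⟨c, a, b, by ext; simp; tauto, h2, h3⟩
  · linarith
  · exact ⟨a, c, b, by ext; simp; tauto, h2, h1⟩
  · exact ⟨a, b, c, by ext; simp, h1, h2⟩
  · linarith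
  · exact ⟨c, b, a, by ext; simp; tauto, h3, h2⟩
  · exact ⟨b, c, a, by ext; simp; tauto, h3, h1⟩

lemma sorted_triple_unique {f : Plane → ℝ} {v i j v' i' j' : Plane} (hi : f i < f v)
    (hj : f v < f j) (hi' : f i' < f v') (hj' : f v' < f j')
    (h : ({v, i, j} : Finset Plane) = {v', i', j'}) : v = v' ∧ i = i' ∧ j = j' := by
  have hv1 : v ∈ ({v', i', j'} : Finset Plane) := h ▸ by simp
  have hi1 : i ∈ ({v', i', j'} : Finset Plane) := h ▸ by simp
  have hj1 : j ∈ ({v', i', j'} : Finset Plane) := h ▸ by simp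
  simp only [Finset.mem_insert, Finset.mem_singleton] at hv1 hi1 hj1
  rcases hv1 with rfl | rfl | rfl <;> rcases hi1 with rfl | rfl | rfl <;>
    rcases hj1 with rfl | rfl | rfl <;> first | (exfalso; linarith) | simp

/-- Each triple is charged to its middle vertex in the order given by `tilt t`, which is unique
because `tilt t` is injective on `Q`. -/
lemma farthestCount_eq_sum {Q : Finset Plane} (hQ : InGeneralPosition Q) {t : ℝ}
    (ht : Set.InjOn (tilt t) Q) :
    farthestCount Q = ∑ v ∈ Q, (middlePairs Q t v).card := by
  classical
  rw [← Finset.card_sigma, farthestCount]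
  symm
  refine Finset.card_bij (fun e _ => {e.1, e.2.1, e.2.2}) ?_ ?_ ?_
  · rintro ⟨v, i, j⟩ h
    simp only [Finset.mem_sigma] at h
    obtain ⟨hv, h⟩ := h
    obtain ⟨hi, hj, hxi, hxj, h⟩ := (mem_middlePairs hQ hv).1 h
    simp only [Finset.mem_filter, Finset.mem_powersetCard]
    refine ⟨⟨by simp [Finset.insert_subset_iff, *], Finset.card_eq_three.2 ⟨v, i, j, ?_, ?_, ?_,
      rfl⟩⟩, fun d hd hdT => ?_⟩
    · rintro rfl; linarith
    · rintro rfl; linarith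
    · rintro rfl; linarith
    · simp only [Finset.mem_insert, Finset.mem_singleton, not_or] at hdT
      exact h d hd hdT.1 hdT.2.1 hdT.2.2
  · rintro ⟨v, i, j⟩ h ⟨v', i', j'⟩ h' heq
    simp only [Finset.mem_sigma] at h h'
    obtain ⟨hv, h⟩ := h
    obtain ⟨hi, hj, hxi, hxj, h⟩ := (mem_middlePairs hQ hv).1 h
    obtain ⟨hv', h'⟩ := h'
    obtain ⟨hi', hj', hxi', hxj', h'⟩ := (mem_middlePairs hQ hv').1 h'
    obtain ⟨rfl, rfl, rfl⟩ := sorted_triple_unique hxi hxj hxi' hxj' heq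
    rfl
  · intro T hT
    simp only [Finset.mem_filter, Finset.mem_powersetCard] at hT
    obtain ⟨⟨hTQ, hcard⟩, h⟩ := hT
    obtain ⟨v, i, j, rfl, hi, hj⟩ := exists_sorted_triple hcard (ht.mono (by exact_mod_cast hTQ))
    simp only [Finset.insert_subset_iff, Finset.singleton_subset_iff] at hTQ
    refine ⟨⟨v, i, j⟩, ?_, rfl⟩
    simp only [Finset.mem_sigma]
    refine ⟨hTQ.1, (mem_middlePairs hQ hTQ.1).2 ⟨hTQ.2.1, hTQ.2.2, hi, hj, ?_⟩⟩
    intro d hd h1 h2 h3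
    exact h d hd (by simp [*])

lemma invX_ne_zero {Q : Finset Plane} {t : ℝ} (ht : Set.InjOn (tilt t) Q) {v p : Plane}
    (hv : v ∈ Q) (hp : p ∈ Q) (h : p ≠ v) : invX t v p ≠ 0 :=
  div_ne_zero (sub_ne_zero.2 (ht.ne hp hv h)) (sqDist_pos h).ne'

/-- A point set in general position with at least two points has two more hull edges than circles
through three of its points that enclose all the other ones. -/
theorem farthestCount_add_two {Q : Finset Plane} (hQ : InGeneralPosition Q) (h2 : 2 ≤ Q.card) :
    farthestCount Q + 2 = hullEdgeCount Q := by
  classical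
  obtain ⟨t, ht⟩ := exists_tilt_injOn Q
  have hne : Q.Nonempty := Finset.card_pos.1 (by omega)
  obtain ⟨l, hl, hmin⟩ := Q.exists_min_image (tilt t) hne
  obtain ⟨r, hr, hmax⟩ := Q.exists_max_image (tilt t) hne
  have hmin' : ∀ p ∈ Q, p ≠ l → tilt t l < tilt t p := fun p hp h =>
    lt_of_le_of_ne (hmin p hp) (ht.ne hl hp (Ne.symm h))
  have hmax' : ∀ p ∈ Q, p ≠ r → tilt t p < tilt t r := fun p hp h =>
    lt_of_le_of_ne (hmax p hp) (ht.ne hp hr h)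
  have hlr : l ≠ r := by
    rintro rfl
    obtain ⟨p, hp, hpl⟩ := Finset.exists_mem_ne (s := Q) (by omega) l
    linarith [hmin' p hp hpl, hmax' p hp hpl]
  have hcross : ∀ v ∈ Q, ∀ i ∈ Q.erase v, ∀ j ∈ Q.erase v, i ≠ j →
      crossAt (invX t v) (invY t v) i j ≠ 0 := by
    intro v hv i hi j hj hij
    obtain ⟨hiv, hi⟩ := Finset.mem_erase.1 hi
    obtain ⟨hjv, hj⟩ := Finset.mem_erase.1 hj
    exact crossAt_inv_ne_zero t hiv hjv (hQ.orient_ne_zero hv hi hj hiv.symm hjv.symm hij)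
  rw [farthestCount_eq_sum hQ ht, hullEdgeCount_eq_sum Q t]
  -- At `l` and `r` all image points lie on one side of the axis, so there is one first ray and no
  -- middle pair. Every other `v` has points on both sides, and the local count applies.
  have key : ∀ v ∈ Q, hullDegree Q t v =
      (middlePairs Q t v).card + ((if v = l then 1 else 0) + (if v = r then 1 else 0)) := by
    intro v hv
    by_cases hvl : v = l
    · subst hvl
      have h1 : hullDegree Q t v = 1 :=
        card_isFirstRay_eq_one ⟨r, Finset.mem_erase.2 ⟨hlr.symm, hr⟩⟩ (hcross v hv)
          (Or.inl fun i hi => by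
            obtain ⟨hiv, hi⟩ := Finset.mem_erase.1 hi
            exact (invX_pos_iff t hiv).2 (hmin' i hi hiv))
      have h2 : middlePairs Q t v = ∅ := by
        rw [Finset.eq_empty_iff_forall_notMem]
        rintro ⟨i, j⟩ h
        obtain ⟨hi, hj, hxi, -⟩ := (mem_middlePairs hQ hv).1 h
        linarith [hmin i hi]
      simp [h1, h2, hlr]
    by_cases hvr : v = r
    · subst hvr
      have h1 : hullDegree Q t v = 1 :=
        card_isFirstRay_eq_one ⟨l, Finset.mem_erase.2 ⟨hlr, hl⟩⟩ (hcross v hv)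
          (Or.inr fun i hi => by
            obtain ⟨hiv, hi⟩ := Finset.mem_erase.1 hi
            exact (invX_neg_iff t hiv).2 (hmax' i hi hiv))
      have h2 : middlePairs Q t v = ∅ := by
        rw [Finset.eq_empty_iff_forall_notMem]
        rintro ⟨i, j⟩ h
        obtain ⟨hi, hj, hxi, hxj, -⟩ := (mem_middlePairs hQ hv).1 h
        linarith [hmax j hj]
      simp [h1, h2, hvl]
    simp only [hvl, hvr, if_false, add_zero]
    symm
    refine card_separatesOrigin_eq ?_ (hcross v hv) ?_ ?_ ?_
    · intro i hi
      obtain ⟨hiv, hi⟩ := Finset.mem_erase.1 hi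
      exact invX_ne_zero ht hv hi hiv
    · intro i hi j hj k hk hij hki hkj
      obtain ⟨hiv, hi⟩ := Finset.mem_erase.1 hi
      obtain ⟨hjv, hj⟩ := Finset.mem_erase.1 hj
      obtain ⟨hkv, hk⟩ := Finset.mem_erase.1 hk
      exact areaAt_inv_ne_zero t hiv hjv hkv (hQ.inCircleDet_ne_zero hv hi hj hk hiv.symm hjv.symm
        hkv.symm hij hki.symm hkj.symm)
    · exact ⟨l, Finset.mem_erase.2 ⟨Ne.symm hvl, hl⟩,
        (invX_neg_iff t (Ne.symm hvl)).2 (hmin' v hv hvl)⟩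
    · exact ⟨r, Finset.mem_erase.2 ⟨Ne.symm hvr, hr⟩,
        (invX_pos_iff t (Ne.symm hvr)).2 (hmax' v hv hvr)⟩
  rw [Finset.sum_congr rfl key, Finset.sum_add_distrib, Finset.sum_add_distrib,
    Finset.sum_ite_eq' Q l, Finset.sum_ite_eq' Q r, if_pos hl, if_pos hr]

end FarthestPoint

/-! ### Double counting over subsets -/

section DoubleCounting

lemma card_supersets_within {α : Type*} [DecidableEq α] {S A B : Finset α} (hA : A ⊆ S)
    (hB : B ⊆ S) (hAB : Disjoint B A) (j : ℕ) :
    ((S.powersetCard (B.card + j)).filter fun Q => B ⊆ Q ∧ Q \ B ⊆ A).card =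
      A.card.choose j := by
  rw [← Finset.card_powersetCard]
  refine Finset.card_nbij' (fun Q => Q \ B) (fun J => B ∪ J) ?_ ?_ ?_ ?_
  · intro Q hQ
    simp only [Finset.coe_filter, Finset.mem_powersetCard, Set.mem_ofPred_eq] at hQ
    simp only [SetLike.mem_coe, Finset.mem_powersetCard]
    refine ⟨hQ.2.2, ?_⟩
    rw [Finset.card_sdiff_of_subset hQ.2.1, hQ.1.2]
    omega
  · intro J hJ
    simp only [SetLike.mem_coe, Finset.mem_powersetCard] at hJ
    simp only [Finset.coe_filter, Finset.mem_powersetCard, Set.mem_ofPred_eq]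
    have hBJ : Disjoint B J := hAB.mono_right hJ.1
    refine ⟨⟨Finset.union_subset hB (hJ.1.trans hA), ?_⟩, Finset.subset_union_left, ?_⟩
    · rw [Finset.card_union_of_disjoint hBJ, hJ.2]
    · rw [Finset.union_sdiff_cancel_left hBJ]
      exact hJ.1
  · intro Q hQ
    simp only [Finset.coe_filter, Finset.mem_powersetCard, Set.mem_ofPred_eq] at hQ
    exact Finset.union_sdiff_of_subset hQ.2.1
  · intro J hJ
    simp only [SetLike.mem_coe, Finset.mem_powersetCard] at hJ
    exact Finset.union_sdiff_cancel_left (hAB.mono_right hJ.1)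

/-- Choosing `j` elements of `A b` amounts to choosing a set `Q` of size `r + j` that contains `B b`
and has its other elements in `A b`. The pairs `(b, Q)` are counted in both orders. -/
lemma sum_choose_eq_sum_powersetCard {α β : Type*} [DecidableEq α] {S : Finset α} {I : Finset β}
    {A B : β → Finset α} {r : ℕ} (hA : ∀ b ∈ I, A b ⊆ S) (hB : ∀ b ∈ I, B b ⊆ S)
    (hAB : ∀ b ∈ I, Disjoint (B b) (A b)) (hr : ∀ b ∈ I, (B b).card = r) (j : ℕ) :
    ∑ b ∈ I, (A b).card.choose j =
      ∑ Q ∈ S.powersetCard (r + j), (I.filter fun b => B b ⊆ Q ∧ Q \ B b ⊆ A b).card := by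
  have h := Finset.sum_card_bipartiteAbove_eq_sum_card_bipartiteBelow (s := I)
    (t := S.powersetCard (r + j)) (fun b Q => B b ⊆ Q ∧ Q \ B b ⊆ A b)
  simp only [Finset.bipartiteAbove, Finset.bipartiteBelow] at h
  rw [← h]
  refine Finset.sum_congr rfl fun b hb => ?_
  rw [← hr b hb, card_supersets_within (hA b hb) (hB b hb) (hAB b hb)]

open Classical in
/-- The number of points of `S` enclosed by the circle through the three points of `T`. -/
noncomputable def insideCount (S T : Finset Plane) : ℕ := (S.filter fun d => Encloses T d).card

open Classical in
/-- The number of points of `S` on the left of the directed line through the two points of `e`. -/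
noncomputable def leftCount (S : Finset Plane) (e : Plane × Plane) : ℕ :=
  (S.filter fun c => 0 < orient e.1 e.2 c).card

lemma InGeneralPosition.circle_through {S T : Finset Plane} (hS : InGeneralPosition S)
    (hT : T ∈ S.powersetCard 3) : ∃! C : EuclideanGeometry.Sphere Plane, ∀ p ∈ T, p ∈ C := by
  classical
  rw [Finset.mem_powersetCard] at hT
  obtain ⟨a, b, c, hab, hac, hbc, rfl⟩ := Finset.card_eq_three.1 hT.2
  have h := hT.1
  simp only [Finset.insert_subset_iff, Finset.singleton_subset_iff] at h
  have ho := hS.orient_ne_zero h.1 h.2.1 h.2.2 hab hac hbc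
  obtain ⟨C, ha, hb, hc⟩ := exists_circle ho
  refine ⟨C, by simp [*], fun C' hC' => ?_⟩
  exact circle_unique ho (hC' a (by simp)) (hC' b (by simp)) (hC' c (by simp)) ha hb hc

lemma not_encloses_of_mem {T : Finset Plane} {d : Plane} (hd : d ∈ T) : ¬ Encloses T d := by
  rintro ⟨C, hC, h⟩
  exact h.ne (EuclideanGeometry.mem_sphere.1 (hC d hd))

lemma sum_insideCount_choose (S : Finset Plane) (j : ℕ) :
    ∑ T ∈ S.powersetCard 3, (insideCount S T).choose j =
      ∑ Q ∈ S.powersetCard (3 + j), farthestCount Q := by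
  classical
  have h := sum_choose_eq_sum_powersetCard (S := S) (I := S.powersetCard 3)
    (A := fun T => S.filter fun d => Encloses T d) (B := id) (r := 3)
    (fun T _ => Finset.filter_subset _ _) (fun T hT => (Finset.mem_powersetCard.1 hT).1)
    (fun T _ => Finset.disjoint_left.2 fun d hd hd' =>
      not_encloses_of_mem hd (Finset.mem_filter.1 hd').2)
    (fun T hT => (Finset.mem_powersetCard.1 hT).2) j
  simp only [insideCount]
  rw [h]
  refine Finset.sum_congr rfl fun Q hQ => ?_
  have hQS := (Finset.mem_powersetCard.1 hQ).1
  rw [farthestCount]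
  congr 1
  ext T
  simp only [Finset.mem_filter, Finset.mem_powersetCard, id]
  constructor
  · rintro ⟨⟨-, h3⟩, hTQ, hsub⟩
    exact ⟨⟨hTQ, h3⟩, fun d hd hdT =>
      (Finset.mem_filter.1 (hsub (Finset.mem_sdiff.2 ⟨hd, hdT⟩))).2⟩
  · rintro ⟨⟨hTQ, h3⟩, h⟩
    refine ⟨⟨hTQ.trans hQS, h3⟩, hTQ, fun d hd => ?_⟩
    obtain ⟨hd, hdT⟩ := Finset.mem_sdiff.1 hd
    exact Finset.mem_filter.2 ⟨hQS hd, h d hd hdT⟩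

lemma orient_self_left (a b : Plane) : orient a b a = 0 := by simp [orient]

lemma orient_self_right (a b : Plane) : orient a b b = 0 := by simp only [orient]; ring

lemma sum_leftCount_choose (S : Finset Plane) (j : ℕ) :
    ∑ e ∈ S.offDiag, (leftCount S e).choose j =
      ∑ Q ∈ S.powersetCard (2 + j), hullEdgeCount Q := by
  classical
  have h := sum_choose_eq_sum_powersetCard (S := S) (I := S.offDiag)
    (A := fun e => S.filter fun c => 0 < orient e.1 e.2 c) (B := fun e => {e.1, e.2}) (r := 2)
    (fun T _ => Finset.filter_subset _ _)
    (fun e he => by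
      rw [Finset.mem_offDiag] at he
      simp [Finset.insert_subset_iff, he.1, he.2.1])
    (fun e he => by
      simp [orient_self_left, orient_self_right])
    (fun e he => Finset.card_pair (Finset.mem_offDiag.1 he).2.2) j
  simp only [leftCount]
  rw [h]
  refine Finset.sum_congr rfl fun Q hQ => ?_
  have hQS := (Finset.mem_powersetCard.1 hQ).1
  rw [hullEdgeCount]
  congr 1
  ext e
  simp only [Finset.mem_filter, Finset.mem_offDiag, Finset.insert_subset_iff,
    Finset.singleton_subset_iff]
  constructor
  · rintro ⟨⟨-, -, hne⟩, ⟨h1, h2⟩, hsub⟩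
    exact ⟨⟨h1, h2, hne⟩, fun c hc hc1 hc2 =>
      (Finset.mem_filter.1 (hsub (Finset.mem_sdiff.2 ⟨hc, by simp [hc1, hc2]⟩))).2⟩
  · rintro ⟨⟨h1, h2, hne⟩, h⟩
    refine ⟨⟨hQS h1, hQS h2, hne⟩, ⟨h1, h2⟩, fun c hc => ?_⟩
    simp only [Finset.mem_sdiff, Finset.mem_insert, Finset.mem_singleton, not_or] at hc
    exact Finset.mem_filter.2 ⟨hQS hc.1, h c hc.1 hc.2.1 hc.2.2⟩

/-- The factorial moments of the numbers of enclosed points are determined by those of the numbers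
of points to the left of the directed edges. -/
theorem sum_insideCount_choose_add {S : Finset Plane} (hS : InGeneralPosition S) (j : ℕ) :
    ∑ T ∈ S.powersetCard 3, (insideCount S T).choose j + 2 * S.card.choose (3 + j) =
      ∑ e ∈ S.offDiag, (leftCount S e).choose (j + 1) := by
  -- An edge has one endpoint fewer than a triple has points, so the shift from `j` to `j + 1` makes
  -- both sums run over the same subsets `Q`, and the claim holds for each `Q` separately.
  rw [sum_insideCount_choose, sum_leftCount_choose, show 2 + (j + 1) = 3 + j by ring,
    ← Finset.card_powersetCard, mul_comm, ← smul_eq_mul, ← Finset.sum_const,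
    ← Finset.sum_add_distrib]
  refine Finset.sum_congr rfl fun Q hQ => ?_
  rw [Finset.mem_powersetCard] at hQ
  exact farthestCount_add_two (hS.mono hQ.1) (by omega)

lemma InGeneralPosition.leftCount_add_swap {S : Finset Plane} (hS : InGeneralPosition S)
    {e : Plane × Plane} (he : e ∈ S.offDiag) :
    leftCount S e + leftCount S e.swap + 2 = S.card := by
  classical
  obtain ⟨a, b⟩ := e
  obtain ⟨ha, hb, hab⟩ := Finset.mem_offDiag.1 he
  have h1 : leftCount S (a, b) + leftCount S (b, a) = (S \ {a, b}).card := by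
    rw [leftCount, leftCount, ← Finset.card_union_of_disjoint]
    · congr 1
      ext c
      simp only [Finset.mem_union, Finset.mem_filter, Finset.mem_sdiff, Finset.mem_insert,
        Finset.mem_singleton, not_or]
      have hswap : orient b a c = -orient a b c := by simp only [orient]; ring
      rw [hswap]
      constructor
      · rintro (⟨hc, h⟩ | ⟨hc, h⟩) <;> refine ⟨hc, ?_, ?_⟩ <;> rintro rfl <;>
          simp [orient_self_left, orient_self_right] at h
      · rintro ⟨hc, hca, hcb⟩
        rcases lt_or_gt_of_ne (hS.orient_ne_zero ha hb hc hab (Ne.symm hca) (Ne.symm hcb)) with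
          h | h
        · exact Or.inr ⟨hc, by linarith⟩
        · exact Or.inl ⟨hc, h⟩
    · rw [Finset.disjoint_left]
      intro c hc hc'
      have hswap : orient b a c = -orient a b c := by simp only [orient]; ring
      have h := (Finset.mem_filter.1 hc).2
      have h' := (Finset.mem_filter.1 hc').2
      simp only [hswap] at h h'
      linarith
  have h2 : ({a, b} : Finset Plane) ⊆ S := by simp [Finset.insert_subset_iff, ha, hb]
  have h3 := Finset.card_sdiff_add_card_eq_card h2
  rw [Finset.card_pair hab] at h3
  simp only [Prod.swap_prod_mk]
  omega

end DoubleCounting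

/-! ### The circle polynomial as a sum over triples -/

section CirclePolynomial

lemma InGeneralPosition.enclosedCount_eq {S T : Finset Plane} (hS : InGeneralPosition S)
    (hT : T ∈ S.powersetCard 3) {C : EuclideanGeometry.Sphere Plane} (hC : ∀ p ∈ T, p ∈ C) :
    enclosedCount S C = insideCount S T := by
  classical
  rw [enclosedCount, insideCount, ← Set.ncard_coe_finset]
  congr 1
  ext d
  simp only [Set.mem_ofPred_eq, Finset.coe_filter]
  refine and_congr_right fun _ => ⟨fun h => ⟨C, hC, h⟩, ?_⟩
  rintro ⟨C', hC', h⟩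
  rwa [(hS.circle_through hT).unique hC hC']

/-- Two different triples on one circle would have at least four cocircular points in their union.
-/
lemma InGeneralPosition.triple_eq_of_mem_circle {S T T' : Finset Plane} (hS : InGeneralPosition S)
    (hT : T ∈ S.powersetCard 3) (hT' : T' ∈ S.powersetCard 3)
    {C : EuclideanGeometry.Sphere Plane} (hC : ∀ p ∈ T, p ∈ C) (hC' : ∀ p ∈ T', p ∈ C) :
    T = T' := by
  classical
  rw [Finset.mem_powersetCard] at hT hT'
  by_contra hne
  have hlt : T ⊂ T ∪ T' := by
    refine Finset.ssubset_iff_subset_ne.2 ⟨Finset.subset_union_left, fun h => hne ?_⟩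
    have : T' ⊆ T := by rw [h]; exact Finset.subset_union_right
    exact (Finset.eq_of_subset_of_card_le this (by omega)).symm
  have h4 := Finset.card_lt_card hlt
  obtain ⟨Q, hQ, hQ4⟩ := Finset.exists_subset_card_eq (s := T ∪ T') (n := 4) (by omega)
  refine hS.2 Q (hQ.trans (Finset.union_subset hT.1 hT'.1)) hQ4 ⟨C.center, C.radius, ?_⟩
  intro p hp
  rcases Finset.mem_union.1 (hQ hp) with h | h
  · exact hC p h
  · exact hC' p h

lemma InGeneralPosition.circleCount_eq {S : Finset Plane} (hS : InGeneralPosition S) (k : ℕ) :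
    circleCount S k = ((S.powersetCard 3).filter fun T => insideCount S T = k).card := by
  classical
  choose! C hC using fun (T : Finset Plane) (hT : T ∈ S.powersetCard 3) =>
    (hS.circle_through hT).exists
  have himage : circlesEnclosing S k =
      C '' ((S.powersetCard 3).filter fun T => insideCount S T = k : Finset (Finset Plane)) := by
    ext D
    simp only [circlesEnclosing, Set.mem_ofPred_eq, Set.mem_image, Finset.coe_filter]
    constructor
    · rintro ⟨⟨T, hTS, hT3, hD⟩, hk⟩
      have hT := Finset.mem_powersetCard.2 ⟨hTS, hT3⟩
      exact ⟨T, ⟨hT, by rw [← hS.enclosedCount_eq hT hD, hk]⟩,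
        (hS.circle_through hT).unique (hC T hT) hD⟩
    · rintro ⟨T, ⟨hT, hk⟩, rfl⟩
      obtain ⟨hTS, hT3⟩ := Finset.mem_powersetCard.1 hT
      exact ⟨⟨T, hTS, hT3, hC T hT⟩, by rw [hS.enclosedCount_eq hT (hC T hT), hk]⟩
  rw [circleCount, himage, Set.InjOn.ncard_image, Set.ncard_coe_finset]
  intro T hT T' hT' h
  simp only [Finset.coe_filter, Set.mem_ofPred_eq] at hT hT'
  exact hS.triple_eq_of_mem_circle hT.1 hT'.1 (hC T hT.1) (h ▸ hC T' hT'.1)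

lemma insideCount_add_three_le {S T : Finset Plane}
    (hT : T ∈ S.powersetCard 3) : insideCount S T + 3 ≤ S.card := by
  classical
  have h := Finset.mem_powersetCard.1 hT
  rw [← h.2, insideCount, ← Finset.card_union_of_disjoint]
  · exact Finset.card_le_card (Finset.union_subset (Finset.filter_subset _ _) h.1)
  · exact Finset.disjoint_right.2 fun d hd hd' =>
      not_encloses_of_mem hd (Finset.mem_filter.1 hd').2

lemma InGeneralPosition.circlePolynomial_eq {S : Finset Plane} (hS : InGeneralPosition S) :
    circlePolynomial S = ∑ T ∈ S.powersetCard 3, Polynomial.X ^ insideCount S T := by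
  classical
  rw [circlePolynomial, ← Finset.sum_fiberwise_of_maps_to (g := insideCount S)
    (t := Finset.range (S.card - 2))]
  · refine Finset.sum_congr rfl fun k _ => ?_
    rw [hS.circleCount_eq, Finset.sum_congr rfl (g := fun _ => Polynomial.X ^ k),
      Finset.sum_const, nsmul_eq_mul]
    · simp
    · intro T hT
      rw [(Finset.mem_filter.1 hT).2]
  · intro T hT
    have := insideCount_add_three_le hT
    rw [Finset.mem_range]
    omega

end CirclePolynomial

/-! ### Crossings and the products of left counts -/

section Crossings

lemma orient_lineComb (a b c d : Plane) (s t : ℝ) (h : s + t = 1) :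
    orient a b (s • c + t • d) = s * orient a b c + t * orient a b d := by
  obtain rfl : s = 1 - t := by linarith
  simp only [orient, PiLp.add_apply, PiLp.smul_apply, smul_eq_mul]
  ring

lemma orient_eq_zero_of_mem_openSegment {a b p : Plane} (h : p ∈ openSegment ℝ a b) :
    orient a b p = 0 := by
  obtain ⟨s, t, -, -, hst, rfl⟩ := h
  rw [orient_lineComb a b a b s t hst, orient_self_left, orient_self_right]
  ring

/-- The segments `ab` and `cd` cross: each of the two lines separates the end points of the other
segment. -/
def SegmentsCross (a b c d : Plane) : Prop :=
  orient a b c * orient a b d < 0 ∧ orient c d a * orient c d b < 0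

lemma SegmentsCross.openSegment_inter {a b c d : Plane} (h : SegmentsCross a b c d) :
    (openSegment ℝ a b ∩ openSegment ℝ c d).Nonempty := by
  -- These are the weights at which an affine function with end values `x` and `y` vanishes. Applied
  -- on both segments, they describe the same intersection point.
  have key : ∀ x y : ℝ, x * y < 0 → 0 < y / (y - x) ∧ 0 < -x / (y - x) ∧
      y / (y - x) + -x / (y - x) = 1 := by
    intro x y hxy
    rcases mul_neg_iff.1 hxy with ⟨hx, hy⟩ | ⟨hx, hy⟩
    · exact ⟨div_pos_of_neg_of_neg hy (by linarith), div_pos_of_neg_of_neg (by linarith)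
        (by linarith), by rw [← add_div]; exact div_self (by linarith)⟩
    · exact ⟨div_pos hy (by linarith), div_pos (by linarith)
        (by linarith), by rw [← add_div]; exact div_self (by linarith)⟩
  obtain ⟨h1, h2, h3⟩ := key _ _ h.1
  obtain ⟨h4, h5, h6⟩ := key _ _ h.2
  refine ⟨_, ⟨_, _, h4, h5, h6, rfl⟩, ⟨_, _, h1, h2, h3, ?_⟩⟩
  have hne : orient c d b - orient c d a ≠ 0 := by
    intro h0
    rw [h0] at h4
    simp at h4
  have hdiff : orient a b d - orient a b c = -(orient c d b - orient c d a) := by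
    simp only [orient]; ring
  rw [hdiff]
  ext i
  refine mul_left_cancel₀ hne ?_
  simp only [PiLp.add_apply, PiLp.smul_apply, smul_eq_mul]
  field_simp
  fin_cases i <;> simp only [orient, Fin.zero_eta, Fin.mk_one] <;> ring

/-- A common point makes a positive combination of the two orientations vanish, so they have
opposite signs or are both zero. If both are zero, general position forces `r` and `s` into `{p,
q}`, so the edges coincide; this also rules out edges sharing one endpoint. -/
lemma InGeneralPosition.orient_mul_neg_of_inter {S : Finset Plane} (hS : InGeneralPosition S)
    {p q r s : Plane} (hp : p ∈ S) (hq : q ∈ S) (hr : r ∈ S) (hs : s ∈ S) (hpq : p ≠ q)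
    (hrs : r ≠ s) (hne : s(p, q) ≠ s(r, s))
    (h : (openSegment ℝ p q ∩ openSegment ℝ r s).Nonempty) :
    orient p q r * orient p q s < 0 := by
  obtain ⟨z, hz, u, w, hu, hw, huw, rfl⟩ := h
  have h0 := orient_eq_zero_of_mem_openSegment hz
  rw [orient_lineComb p q r s u w huw] at h0
  have hmem : ∀ x ∈ S, orient p q x = 0 → x = p ∨ x = q := by
    intro x hx hx0
    by_contra! hxne
    exact hS.orient_ne_zero hp hq hx hpq hxne.1.symm hxne.2.symm hx0
  have hr0 : orient p q r ≠ 0 := by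
    intro hr0
    have hs0 : orient p q s = 0 := by
      rw [hr0, mul_zero, zero_add] at h0
      exact (mul_eq_zero.1 h0).resolve_left hw.ne'
    rcases hmem r hr hr0 with rfl | rfl <;> rcases hmem s hs hs0 with rfl | rfl
    · exact hrs rfl
    · exact hne rfl
    · exact hne Sym2.eq_swap
    · exact hrs rfl
  have h1 : w * (orient p q r * orient p q s) = -u * orient p q r ^ 2 := by
    linear_combination orient p q r * h0
  have h2 : 0 < orient p q r ^ 2 := by positivity
  by_contra! h3
  nlinarith [mul_nonneg hw.le h3, mul_pos hu h2]

lemma ne_of_orient_mul_neg {a b c d : Plane} (h : orient a b c * orient a b d < 0) :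
    a ≠ b ∧ a ≠ c ∧ a ≠ d ∧ b ≠ c ∧ b ≠ d ∧ c ≠ d := by
  refine ⟨?_, ?_, ?_, ?_, ?_, ?_⟩ <;> rintro rfl
  · simp [orient] at h
  · simp [orient_self_left] at h
  · simp [orient_self_left] at h
  · simp [orient_self_right] at h
  · simp [orient_self_right] at h
  · exact absurd h (mul_self_nonneg _).not_gt

lemma SegmentsCross.swap_left {a b c d : Plane} (h : SegmentsCross a b c d) :
    SegmentsCross b a c d := by
  have h1 : ∀ x, orient b a x = -orient a b x := fun x => by simp only [orient]; ring
  refine ⟨?_, by rw [mul_comm]; exact h.2⟩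
  rw [h1, h1, neg_mul_neg]
  exact h.1

lemma SegmentsCross.symm {a b c d : Plane} (h : SegmentsCross a b c d) :
    SegmentsCross c d a b := ⟨h.2, h.1⟩

lemma SegmentsCross.swap_right {a b c d : Plane} (h : SegmentsCross a b c d) :
    SegmentsCross a b d c := h.symm.swap_left.symm

open Classical in
/-- The ordered quadruples `(a, b, c, d)` of points of `S` such that `ab` and `cd` cross. -/
noncomputable def crossingQuadruples (S : Finset Plane) : Finset (Plane × Plane × Plane × Plane) :=
  (S ×ˢ S ×ˢ S ×ˢ S).filter fun e => SegmentsCross e.1 e.2.1 e.2.2.1 e.2.2.2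

lemma mem_crossingQuadruples {S : Finset Plane} {a b c d : Plane} :
    (a, b, c, d) ∈ crossingQuadruples S ↔
      (a ∈ S ∧ b ∈ S ∧ c ∈ S ∧ d ∈ S) ∧ SegmentsCross a b c d := by
  simp [crossingQuadruples]

/-- The unordered pair of unordered pairs underlying a quadruple. -/
def quadruplePairs (e : Plane × Plane × Plane × Plane) : Sym2 (Sym2 Plane) :=
  s(s(e.1, e.2.1), s(e.2.2.1, e.2.2.2))

lemma InGeneralPosition.edgeCrossings_eq {S : Finset Plane} (hS : InGeneralPosition S) :
    edgeCrossings S = quadruplePairs '' (crossingQuadruples S : Set _) := by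
  ext x
  simp only [edgeCrossings, Set.mem_ofPred_eq, Set.mem_image, Prod.exists, SetLike.mem_coe,
    mem_crossingQuadruples]
  constructor
  · rintro ⟨p, hp, q, hq, r, hr, s, hs, hpq, hrs, hne, rfl, h⟩
    exact ⟨p, q, r, s, ⟨⟨hp, hq, hr, hs⟩,
      hS.orient_mul_neg_of_inter hp hq hr hs hpq hrs hne h,
      hS.orient_mul_neg_of_inter hr hs hp hq hrs hpq hne.symm (by rwa [Set.inter_comm])⟩, rfl⟩
  · rintro ⟨p, q, r, s, ⟨⟨hp, hq, hr, hs⟩, h⟩, rfl⟩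
    obtain ⟨h1, h2, h3, h4, h5, h6⟩ := ne_of_orient_mul_neg h.1
    exact ⟨p, hp, q, hq, r, hr, s, hs, h1, h6, by simp [h2, h3], rfl,
      h.openSegment_inter⟩

/-- The eight quadruples come from reversing either segment and exchanging the two. -/
lemma card_quadruplePairs_fiber {S : Finset Plane} {e : Plane × Plane × Plane × Plane}
    (he : e ∈ crossingQuadruples S) [DecidableEq (Sym2 (Sym2 Plane))] :
    ((crossingQuadruples S).filter fun e' => quadruplePairs e' = quadruplePairs e).card = 8 := by
  classical
  obtain ⟨a, b, c, d⟩ := e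
  obtain ⟨⟨ha, hb, hc, hd⟩, h⟩ := mem_crossingQuadruples.1 he
  obtain ⟨h1, h2, h3, h4, h5, h6⟩ := ne_of_orient_mul_neg h.1
  have heq : (crossingQuadruples S).filter
      (fun e' => quadruplePairs e' = quadruplePairs (a, b, c, d)) =
      {(a, b, c, d), (b, a, c, d), (a, b, d, c), (b, a, d, c),
        (c, d, a, b), (d, c, a, b), (c, d, b, a), (d, c, b, a)} := by
    ext ⟨p, q, r, s⟩
    rw [Finset.mem_filter, mem_crossingQuadruples]
    simp only [Finset.mem_insert, Finset.mem_singleton, Prod.mk.injEq, quadruplePairs]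
    constructor
    · rintro ⟨-, h⟩
      simp only [Sym2.eq_iff] at h
      rcases h with ⟨⟨rfl, rfl⟩ | ⟨rfl, rfl⟩, ⟨rfl, rfl⟩ | ⟨rfl, rfl⟩⟩ |
        ⟨⟨rfl, rfl⟩ | ⟨rfl, rfl⟩, ⟨rfl, rfl⟩ | ⟨rfl, rfl⟩⟩ <;> simp
    · rintro (⟨rfl, rfl, rfl, rfl⟩ | ⟨rfl, rfl, rfl, rfl⟩ | ⟨rfl, rfl, rfl, rfl⟩ |
        ⟨rfl, rfl, rfl, rfl⟩ | ⟨rfl, rfl, rfl, rfl⟩ | ⟨rfl, rfl, rfl, rfl⟩ |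
        ⟨rfl, rfl, rfl, rfl⟩ | ⟨rfl, rfl, rfl, rfl⟩)
      · exact ⟨⟨⟨ha, hb, hc, hd⟩, h⟩, by simp⟩
      · exact ⟨⟨⟨hb, ha, hc, hd⟩, h.swap_left⟩, by simp⟩
      · exact ⟨⟨⟨ha, hb, hd, hc⟩, h.swap_right⟩, by simp⟩
      · exact ⟨⟨⟨hb, ha, hd, hc⟩, h.swap_left.swap_right⟩, by simp⟩
      · exact ⟨⟨⟨hc, hd, ha, hb⟩, h.symm⟩, by simp⟩
      · exact ⟨⟨⟨hd, hc, ha, hb⟩, h.symm.swap_left⟩, by simp⟩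
      · exact ⟨⟨⟨hc, hd, hb, ha⟩, h.symm.swap_right⟩, by simp⟩
      · exact ⟨⟨⟨hd, hc, hb, ha⟩, h.symm.swap_left.swap_right⟩, by simp⟩
  rw [heq]
  simp [Finset.card_insert_of_notMem, h1, h2, h3, h4, h5, h6, h1.symm, h2.symm, h3.symm, h4.symm,
    h5.symm, h6.symm]

lemma InGeneralPosition.card_crossingQuadruples {S : Finset Plane} (hS : InGeneralPosition S) :
    (crossingQuadruples S).card = 8 * rectilinearCrossingNumber S := by
  classical
  rw [rectilinearCrossingNumber, hS.edgeCrossings_eq, ← Finset.coe_image, Set.ncard_coe_finset,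
    Finset.card_eq_sum_card_image quadruplePairs, Finset.sum_congr rfl (g := fun _ => 8)]
  · simp [mul_comm]
  · intro x hx
    obtain ⟨e, he, rfl⟩ := Finset.mem_image.1 hx
    exact card_quadruplePairs_fiber he

/-- The sum of `F` over all quadruples of elements of `S`. -/
def quadSum {α : Type*} (S : Finset α) (F : α → α → α → α → ℕ) : ℕ :=
  ∑ a ∈ S, ∑ b ∈ S, ∑ c ∈ S, ∑ d ∈ S, F a b c d

section QuadSum

variable {α : Type*} (S : Finset α) (F : α → α → α → α → ℕ)

lemma quadSum_swap_first : quadSum S (fun a b c d => F b a c d) = quadSum S F :=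
  Finset.sum_comm

lemma quadSum_swap_middle : quadSum S (fun a b c d => F a c b d) = quadSum S F :=
  Finset.sum_congr rfl fun _ _ => Finset.sum_comm

lemma quadSum_swap_last : quadSum S (fun a b c d => F a b d c) = quadSum S F :=
  Finset.sum_congr rfl fun _ _ => Finset.sum_congr rfl fun _ _ => Finset.sum_comm

lemma quadSum_swap_pairs : quadSum S (fun a b c d => F c d a b) = quadSum S F := by
  rw [quadSum_swap_middle S (fun a b c d => F b d a c), quadSum_swap_first S
    (fun a b c d => F a d b c), quadSum_swap_last S (fun a b c d => F a c b d),
    quadSum_swap_middle S F]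

lemma quadSum_add (G : α → α → α → α → ℕ) :
    quadSum S (fun a b c d => F a b c d + G a b c d) = quadSum S F + quadSum S G := by
  simp only [quadSum, Finset.sum_add_distrib]

end QuadSum

-- `A`, `B`, `C`, `D` stand for the orientations of `abc`, `abd`, `acd`, `bcd`. In convex position
-- the two diagonals each separate the remaining two points and there is one crossing; otherwise the
-- three lines through the inner point separate and nothing crosses. Both cases give 3, and the
-- linear relation excludes the remaining sign patterns.
open Classical in
lemma sign_pattern_count {A B C D : ℝ} (hA : A ≠ 0) (hB : B ≠ 0) (hC : C ≠ 0) (hD : D ≠ 0)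
    (h : A - B + C - D = 0) :
    (if A * B < 0 then 1 else 0) + (if C * D < 0 then 1 else 0) + (if -A * C < 0 then 1 else 0) +
      (if B * -D < 0 then 1 else 0) + (if -B * -C < 0 then 1 else 0) +
      (if A * D < 0 then 1 else 0) + (if A * B < 0 ∧ C * D < 0 then 1 else 0) +
      (if -A * C < 0 ∧ B * -D < 0 then 1 else 0) + (if -B * -C < 0 ∧ A * D < 0 then 1 else 0) =
      3 := by
  rcases lt_or_gt_of_ne hA with hA | hA <;> rcases lt_or_gt_of_ne hB with hB | hB <;>
    rcases lt_or_gt_of_ne hC with hC | hC <;> rcases lt_or_gt_of_ne hD with hD | hD <;>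
    first
    | (exfalso; linarith)
    | simp [mul_neg_iff, mul_pos_iff, hA, hB, hC, hD, hA.not_gt, hB.not_gt, hC.not_gt, hD.not_gt]

open Classical in
/-- Indicator of the line `ab` separating `c` from `d`. -/
noncomputable def splits (a b c d : Plane) : ℕ :=
  if orient a b c * orient a b d < 0 then 1 else 0

open Classical in
/-- Indicator of the segments `ab` and `cd` crossing. -/
noncomputable def crosses (a b c d : Plane) : ℕ := if SegmentsCross a b c d then 1 else 0

open Classical in
lemma InGeneralPosition.splits_add_crosses {S : Finset Plane} (hS : InGeneralPosition S)
    {a b c d : Plane} (ha : a ∈ S) (hb : b ∈ S) (hc : c ∈ S) (hd : d ∈ S) :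
    splits a b c d + splits c d a b + splits a c b d + splits b d a c + splits a d b c +
      splits b c a d + crosses a b c d + crosses a c b d + crosses a d b c =
      if a ≠ b ∧ c ≠ d ∧ (a ≠ c ∧ b ≠ c) ∧ a ≠ d ∧ b ≠ d then 3 else 0 := by
  split_ifs with h
  · obtain ⟨hab, hcd, ⟨hac, hbc⟩, had, hbd⟩ := h
    have h1 : orient c d a = orient a c d := by simp only [orient]; ring
    have h2 : orient c d b = orient b c d := by simp only [orient]; ring
    have h3 : orient a c b = -orient a b c := by simp only [orient]; ring
    have h4 : orient b d a = orient a b d := by simp only [orient]; ring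
    have h5 : orient b d c = -orient b c d := by simp only [orient]; ring
    have h6 : orient a d b = -orient a b d := by simp only [orient]; ring
    have h7 : orient a d c = -orient a c d := by simp only [orient]; ring
    have h8 : orient b c a = orient a b c := by simp only [orient]; ring
    have := sign_pattern_count (hS.orient_ne_zero ha hb hc hab hac hbc)
      (hS.orient_ne_zero ha hb hd hab had hbd) (hS.orient_ne_zero ha hc hd hac had hcd)
      (hS.orient_ne_zero hb hc hd hbc hbd hcd) (by simp only [orient]; ring)
    simp only [splits, crosses, SegmentsCross, h1, h2, h3, h4, h5, h6, h7, h8]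
    exact this
  · have key : ∀ {p q r s : Plane}, (p ≠ q ∧ p ≠ r ∧ p ≠ s ∧ q ≠ r ∧ q ≠ s ∧ r ≠ s →
        a ≠ b ∧ c ≠ d ∧ (a ≠ c ∧ b ≠ c) ∧ a ≠ d ∧ b ≠ d) →
        splits p q r s = 0 ∧ crosses p q r s = 0 := by
      intro p q r s hpq
      exact ⟨if_neg fun h' => h (hpq (ne_of_orient_mul_neg h')),
        if_neg fun h' => h (hpq (ne_of_orient_mul_neg h'.1))⟩
    rw [(key (p := a) (q := b) (r := c) (s := d) (by tauto)).1,
      (key (p := a) (q := b) (r := c) (s := d) (by tauto)).2,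
      (key (p := c) (q := d) (r := a) (s := b) (by grind)).1,
      (key (p := a) (q := c) (r := b) (s := d) (by grind)).1,
      (key (p := a) (q := c) (r := b) (s := d) (by grind)).2,
      (key (p := b) (q := d) (r := a) (s := c) (by grind)).1,
      (key (p := a) (q := d) (r := b) (s := c) (by grind)).1,
      (key (p := a) (q := d) (r := b) (s := c) (by grind)).2,
      (key (p := b) (q := c) (r := a) (s := d) (by grind)).1]

open Classical in
lemma quadSum_distinct {α : Type*} (S : Finset α) :
    quadSum S (fun a b c d =>
      if a ≠ b ∧ c ≠ d ∧ (a ≠ c ∧ b ≠ c) ∧ a ≠ d ∧ b ≠ d then 3 else 0) =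
      3 * (S.card * (S.card - 1) * ((S.card - 2) * (S.card - 3))) := by
  have h1 : ∀ a ∈ S, ∀ b ∈ S, ∑ c ∈ S, ∑ d ∈ S,
      (if a ≠ b ∧ c ≠ d ∧ (a ≠ c ∧ b ≠ c) ∧ a ≠ d ∧ b ≠ d then 3 else 0) =
      if a ≠ b then 3 * ((S.card - 2) * (S.card - 3)) else 0 := by
    intro a ha b hb
    by_cases hab : a = b
    · simp [hab]
    rw [if_pos hab, ← Finset.sum_product', ← Finset.sum_filter]
    have : (S ×ˢ S).filter (fun e => a ≠ b ∧ e.1 ≠ e.2 ∧ (a ≠ e.1 ∧ b ≠ e.1) ∧ a ≠ e.2 ∧ b ≠ e.2) =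
        (S \ {a, b}).offDiag := by
      ext ⟨c, d⟩
      simp only [Finset.mem_filter, Finset.mem_product, Finset.mem_offDiag, Finset.mem_sdiff,
        Finset.mem_insert, Finset.mem_singleton]
      grind
    rw [this, Finset.sum_const, Finset.offDiag_card, Finset.card_sdiff_of_subset
      (by simp [Finset.insert_subset_iff, ha, hb]), Finset.card_pair hab, smul_eq_mul, mul_comm,
      ← Nat.mul_sub_one, Nat.sub_sub]
  rw [quadSum, Finset.sum_congr rfl fun a ha => Finset.sum_congr rfl fun b hb => h1 a ha b hb,
    ← Finset.sum_product', ← Finset.sum_filter]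
  have : (S ×ˢ S).filter (fun e => e.1 ≠ e.2) = S.offDiag := by
    ext ⟨c, d⟩
    simp [Finset.mem_offDiag, and_assoc]
  rw [this, Finset.sum_const, Finset.offDiag_card, smul_eq_mul, ← Nat.mul_sub_one]
  ring

lemma quadSum_crosses (S : Finset Plane) :
    quadSum S crosses = (crossingQuadruples S).card := by
  classical
  rw [crossingQuadruples, Finset.card_filter]
  simp only [Finset.sum_product]
  rfl

/-- One of `c`, `d` is to the left of `ab` and the other to its right, in either order, whence the
factor 2. Terms with `a = b` vanish because the orientation is zero. -/
lemma quadSum_splits (S : Finset Plane) :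
    quadSum S splits = 2 * ∑ e ∈ S.offDiag, leftCount S e * leftCount S e.swap := by
  classical
  have h1 : ∀ a b, ∑ c ∈ S, ∑ d ∈ S, splits a b c d =
      2 * (leftCount S (a, b) * leftCount S (b, a)) := by
    intro a b
    have hswap : ∀ c, orient b a c = -orient a b c := fun c => by simp only [orient]; ring
    have h : ∀ c d, splits a b c d =
        (if 0 < orient a b c then 1 else 0) * (if 0 < orient b a d then 1 else 0) +
        (if 0 < orient b a c then 1 else 0) * (if 0 < orient a b d then 1 else 0) := by
      intro c d
      rw [splits, hswap, hswap]
      simp only [mul_neg_iff, Left.neg_pos_iff]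
      by_cases h1 : 0 < orient a b c <;> by_cases h2 : 0 < orient a b d <;>
        by_cases h3 : orient a b c < 0 <;> by_cases h4 : orient a b d < 0 <;>
        first | (exfalso; linarith) | simp [h1, h2, h3, h4]
    simp only [h, Finset.sum_add_distrib, ← Finset.sum_mul_sum, leftCount, Finset.card_filter]
    ring
  simp only [quadSum, h1]
  rw [← Finset.sum_product', ← Finset.mul_sum]
  congr 1
  symm
  refine Finset.sum_subset (fun e he => ?_) fun e he he' => ?_
  · rw [Finset.mem_offDiag] at he
    exact Finset.mem_product.2 ⟨he.1, he.2.1⟩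
  · have : e.1 = e.2 := by
      rw [Finset.mem_product] at he
      by_contra hne
      exact he' (Finset.mem_offDiag.2 ⟨he.1, he.2, hne⟩)
    obtain ⟨a, b⟩ := e
    obtain rfl : a = b := this
    simp [leftCount, orient]

theorem InGeneralPosition.sum_leftCount_mul_add {S : Finset Plane} (hS : InGeneralPosition S) :
    4 * ∑ e ∈ S.offDiag, leftCount S e * leftCount S e.swap + 8 * rectilinearCrossingNumber S =
      S.card * (S.card - 1) * ((S.card - 2) * (S.card - 3)) := by
  classical
  have h : quadSum S (fun a b c d => splits a b c d + splits c d a b + splits a c b d +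
      splits b d a c + splits a d b c + splits b c a d + crosses a b c d + crosses a c b d +
      crosses a d b c) = quadSum S (fun a b c d =>
      if a ≠ b ∧ c ≠ d ∧ (a ≠ c ∧ b ≠ c) ∧ a ≠ d ∧ b ≠ d then 3 else 0) :=
    Finset.sum_congr rfl fun a ha => Finset.sum_congr rfl fun b hb => Finset.sum_congr rfl
      fun c hc => Finset.sum_congr rfl fun d hd => hS.splits_add_crosses ha hb hc hd
  have h5 : ∀ F : Plane → Plane → Plane → Plane → ℕ,
      quadSum S (fun a b c d => F a d b c) = quadSum S F := fun F => by
    rw [quadSum_swap_last S (fun a b c d => F a c b d), quadSum_swap_middle S F]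
  replace h := h.trans (by convert quadSum_distinct S)
  -- Relabeling turns the nine sums into six copies of the sum of `splits` and three of the sum of
  -- `crosses`; the common factor 3 cancels at the end.
  simp only [quadSum_add] at h
  rw [quadSum_swap_pairs S splits, quadSum_swap_middle S splits,
    quadSum_swap_middle S (fun a b c d => splits c d a b), quadSum_swap_pairs S splits,
    h5 splits, quadSum_swap_first S (fun a b c d => splits a c b d), quadSum_swap_middle S splits,
    quadSum_swap_middle S crosses, h5 crosses] at h
  have h6 : quadSum S (fun a b c d => splits a b c d) = quadSum S splits := rfl
  have h7 : quadSum S (fun a b c d => crosses a b c d) = quadSum S crosses := rfl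
  rw [h6, h7, quadSum_crosses, quadSum_splits, hS.card_crossingQuadruples] at h
  omega

end Crossings

/-! ### Evaluating the moments -/

section Moments

lemma sum_offDiag_swap {M : Type*} [AddCommMonoid M] (S : Finset Plane) (f : Plane × Plane → M) :
    ∑ e ∈ S.offDiag, f e.swap = ∑ e ∈ S.offDiag, f e := by
  refine Finset.sum_nbij' Prod.swap Prod.swap ?_ ?_ ?_ ?_ ?_
  · intro e he
    simp only [Prod.fst_swap, Prod.snd_swap, Finset.mem_offDiag] at he ⊢
    exact ⟨he.2.1, he.1, he.2.2.symm⟩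
  · intro e he
    simp only [Prod.fst_swap, Prod.snd_swap, Finset.mem_offDiag] at he ⊢
    exact ⟨he.2.1, he.1, he.2.2.symm⟩
  · intro e _; simp
  · intro e _; simp
  · intro e _; simp

lemma cast_choose_three (n : ℕ) : (n.choose 3 : ℂ) = n * (n - 1) * (n - 2) / 6 := by
  rw [Nat.cast_choose_eq_descPochhammer_div]
  simp [descPochhammer_succ_right, Nat.factorial]

lemma cast_choose_four (n : ℕ) : (n.choose 4 : ℂ) = n * (n - 1) * (n - 2) * (n - 3) / 24 := by
  rw [Nat.cast_choose_eq_descPochhammer_div]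
  simp [descPochhammer_succ_right, Nat.factorial]

lemma cast_choose_five (n : ℕ) :
    (n.choose 5 : ℂ) = n * (n - 1) * (n - 2) * (n - 3) * (n - 4) / 120 := by
  rw [Nat.cast_choose_eq_descPochhammer_div]
  simp [descPochhammer_succ_right, Nat.factorial]

/-- This is the binomial expansion of `(1 - 2) ^ l`, padded with zero terms up to a bound `N`
independent of `l` so that sums can be exchanged later. -/
lemma sum_neg_two_pow_mul_choose {l N : ℕ} (h : l ≤ N) :
    ∑ j ∈ Finset.range (N + 1), (-2 : ℂ) ^ j * (l.choose j : ℂ) = (-1) ^ l := by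
  have h1 := add_pow (-2 : ℂ) 1 l
  rw [show (-2 + 1 : ℂ) = -1 by norm_num] at h1
  rw [h1]
  symm
  refine (Finset.sum_subset (Finset.range_mono (by omega)) fun j _ hj => ?_).trans
    (Finset.sum_congr rfl fun j _ => by simp)
  rw [Finset.mem_range] at hj
  rw [Nat.choose_eq_zero_of_lt (by omega)]
  simp

lemma sum_neg_two_pow_mul_choose_succ {l N : ℕ} (h : l ≤ N) :
    ∑ j ∈ Finset.range N, (-2 : ℂ) ^ j * (l.choose (j + 1) : ℂ) = (1 - (-1) ^ l) / 2 := by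
  have h1 := sum_neg_two_pow_mul_choose h
  rw [Finset.sum_range_succ'] at h1
  have h2 : ∑ j ∈ Finset.range N, (-2 : ℂ) ^ (j + 1) * (l.choose (j + 1) : ℂ) =
      -2 * ∑ j ∈ Finset.range N, (-2 : ℂ) ^ j * (l.choose (j + 1) : ℂ) := by
    rw [Finset.mul_sum]
    exact Finset.sum_congr rfl fun j _ => by ring
  rw [h2] at h1
  simp only [pow_zero, Nat.choose_zero_right, Nat.cast_one, mul_one] at h1
  linear_combination -h1 / 2

lemma sum_neg_two_pow_mul_choose_add_three (n : ℕ) :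
    ∑ j ∈ Finset.range (n + 1), (-2 : ℂ) ^ j * (n.choose (3 + j) : ℂ) =
      (1 - 2 * n + 2 * n * (n - 1) - (-1) ^ n) / 8 := by
  -- The bound `n + 3` leaves exactly `range (n + 1)` after the terms for 0, 1 and 2 are split off.
  have h1 := sum_neg_two_pow_mul_choose (show n ≤ n + 3 by omega)
  rw [show n + 3 + 1 = n + 1 + 1 + 1 + 1 by ring, Finset.sum_range_succ', Finset.sum_range_succ',
    Finset.sum_range_succ'] at h1
  have h2 : ∑ j ∈ Finset.range (n + 1), (-2 : ℂ) ^ (j + 1 + 1 + 1) *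
      (n.choose (j + 1 + 1 + 1) : ℂ) =
      -8 * ∑ j ∈ Finset.range (n + 1), (-2 : ℂ) ^ j * (n.choose (3 + j) : ℂ) := by
    rw [Finset.mul_sum]
    exact Finset.sum_congr rfl fun j _ => by
      rw [show j + 1 + 1 + 1 = 3 + j by ring]; ring
  rw [h2] at h1
  simp only [zero_add, pow_zero, pow_one, Nat.choose_zero_right, Nat.choose_one_right, Nat.cast_one,
    mul_one, one_add_one_eq_two, Nat.cast_choose_two] at h1
  linear_combination -h1 / 8

variable {S : Finset Plane}

lemma InGeneralPosition.sum_mul_leftCount (hS : InGeneralPosition S) (h : 4 ≤ S.card) :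
    ∑ e ∈ S.offDiag, (leftCount S e : ℂ) * leftCount S e.swap =
      6 * (S.card.choose 4 : ℂ) - 2 * rectilinearCrossingNumber S := by
  have h1 := hS.sum_leftCount_mul_add
  obtain ⟨m, hm⟩ := Nat.exists_eq_add_of_le' h
  rw [hm, show m + 4 - 1 = m + 3 by omega, show m + 4 - 2 = m + 2 by omega,
    show m + 4 - 3 = m + 1 by omega] at h1
  have h2 := congrArg (Nat.cast : ℕ → ℂ) h1
  push_cast at h2
  rw [cast_choose_four, hm]
  push_cast
  linear_combination h2 / 4

lemma card_offDiag_cast (S : Finset Plane) :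
    (S.offDiag.card : ℂ) = (S.card : ℂ) * (S.card - 1) := by
  rw [Finset.offDiag_card, Nat.cast_sub (Nat.le_mul_self _)]
  push_cast
  ring

lemma InGeneralPosition.cast_leftCount_add (hS : InGeneralPosition S) {e : Plane × Plane}
    (he : e ∈ S.offDiag) :
    (leftCount S e.swap : ℂ) = (S.card : ℂ) - 2 - leftCount S e := by
  rw [← hS.leftCount_add_swap he]
  push_cast
  ring

lemma InGeneralPosition.sum_leftCount_choose_two (hS : InGeneralPosition S) (h : 4 ≤ S.card) :
    ∑ e ∈ S.offDiag, ((leftCount S e).choose 2 : ℂ) =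
      3 * (S.card.choose 4 : ℂ) + rectilinearCrossingNumber S := by
  -- Symmetrizing over edge reversal: if `l + m = n - 2`, then `l.choose 2 + m.choose 2` is `(n -
  -- 2).choose 2 - l * m`.
  have h1 : ∑ e ∈ S.offDiag, (((leftCount S e).choose 2 : ℂ) + (leftCount S e.swap).choose 2) =
      ∑ e ∈ S.offDiag, (((S.card : ℂ) - 2) * ((S.card : ℂ) - 3) / 2 -
        (leftCount S e : ℂ) * leftCount S e.swap) := by
    refine Finset.sum_congr rfl fun e he => ?_
    rw [Nat.cast_choose_two, Nat.cast_choose_two, hS.cast_leftCount_add he]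
    ring
  rw [Finset.sum_add_distrib, sum_offDiag_swap S fun e => ((leftCount S e).choose 2 : ℂ),
    Finset.sum_sub_distrib, Finset.sum_const, nsmul_eq_mul, hS.sum_mul_leftCount h,
    card_offDiag_cast, cast_choose_four] at h1
  rw [cast_choose_four]
  linear_combination h1 / 2

lemma InGeneralPosition.sum_leftCount_choose_three (hS : InGeneralPosition S) (h : 4 ≤ S.card) :
    2 * ∑ e ∈ S.offDiag, ((leftCount S e).choose 3 : ℂ) =
      5 * (S.card.choose 5 : ℂ) + ((S.card : ℂ) - 4) * rectilinearCrossingNumber S := by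
  -- The cubic terms also reduce to the product: `l.choose 3 + m.choose 3` is `(n - 2).choose 3 - (n
  -- - 4) / 2 * (l * m)`. No such reduction to a single product is needed beyond this degree.
  have h1 : ∑ e ∈ S.offDiag, (((leftCount S e).choose 3 : ℂ) + (leftCount S e.swap).choose 3) =
      ∑ e ∈ S.offDiag, (((S.card : ℂ) - 2) * ((S.card : ℂ) - 3) * ((S.card : ℂ) - 4) / 6 -
        ((S.card : ℂ) - 4) / 2 * ((leftCount S e : ℂ) * leftCount S e.swap)) := by
    refine Finset.sum_congr rfl fun e he => ?_
    rw [cast_choose_three, cast_choose_three, hS.cast_leftCount_add he]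
    ring
  rw [Finset.sum_add_distrib, sum_offDiag_swap S fun e => ((leftCount S e).choose 3 : ℂ),
    Finset.sum_sub_distrib, Finset.sum_const, nsmul_eq_mul, ← Finset.mul_sum,
    hS.sum_mul_leftCount h, card_offDiag_cast, cast_choose_four] at h1
  rw [cast_choose_five]
  linear_combination h1

/-- For odd `n` the left counts of an edge and its reverse have odd sum `n - 2`, so their signs are
opposite and cancel. -/
lemma InGeneralPosition.sum_neg_one_pow_leftCount (hS : InGeneralPosition S)
    (hodd : Odd S.card) : ∑ e ∈ S.offDiag, (-1 : ℂ) ^ leftCount S e = 0 := by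
  have h1 : ∑ e ∈ S.offDiag, (-1 : ℂ) ^ leftCount S e.swap =
      ∑ e ∈ S.offDiag, -(-1 : ℂ) ^ leftCount S e := by
    refine Finset.sum_congr rfl fun e he => ?_
    have h := hS.leftCount_add_swap he
    rw [← h] at hodd
    have hodd' : Odd (leftCount S e + leftCount S e.swap) := by
      rcases hodd with ⟨k, hk⟩
      exact ⟨k - 1, by omega⟩
    have h2 := hodd'.neg_one_pow (α := ℂ)
    rw [pow_add] at h2
    rcases neg_one_pow_eq_or ℂ (leftCount S e) with h3 | h3 <;> rw [h3] at h2 ⊢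
    · linear_combination h2
    · linear_combination -h2
  rw [sum_offDiag_swap S fun e => (-1 : ℂ) ^ leftCount S e, Finset.sum_neg_distrib] at h1
  linear_combination h1 / 2

lemma InGeneralPosition.cast_sum_insideCount_choose (hS : InGeneralPosition S) (j : ℕ) :
    ∑ T ∈ S.powersetCard 3, ((insideCount S T).choose j : ℂ) =
      ∑ e ∈ S.offDiag, ((leftCount S e).choose (j + 1) : ℂ) - 2 * (S.card.choose (3 + j) : ℂ) := by
  have h := congrArg (Nat.cast : ℕ → ℂ) (sum_insideCount_choose_add hS j)
  push_cast at h
  linear_combination h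

lemma InGeneralPosition.sum_neg_one_pow_insideCount (hS : InGeneralPosition S)
    (hodd : Odd S.card) :
    ∑ T ∈ S.powersetCard 3, (-1 : ℂ) ^ insideCount S T = ((S.card : ℂ) - 1) / 2 := by
  have h1 : ∀ T ∈ S.powersetCard 3, (-1 : ℂ) ^ insideCount S T =
      ∑ j ∈ Finset.range (S.card + 1), (-2 : ℂ) ^ j * ((insideCount S T).choose j : ℂ) := by
    intro T hT
    rw [sum_neg_two_pow_mul_choose (by have := insideCount_add_three_le hT; omega)]
  have h2 : ∀ e ∈ S.offDiag, ∑ j ∈ Finset.range (S.card + 1),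
      (-2 : ℂ) ^ j * ((leftCount S e).choose (j + 1) : ℂ) = (1 - (-1) ^ leftCount S e) / 2 := by
    intro e he
    exact sum_neg_two_pow_mul_choose_succ (by have := hS.leftCount_add_swap he; omega)
  -- Exchanging the sums lets the moment identity be applied for each `j`; the resulting sums over
  -- `j` are then resummed in closed form.
  rw [Finset.sum_congr rfl h1, Finset.sum_comm]
  simp only [← Finset.mul_sum, hS.cast_sum_insideCount_choose, mul_sub, mul_left_comm _ (2 : ℂ)]
  rw [Finset.sum_sub_distrib, ← Finset.mul_sum, sum_neg_two_pow_mul_choose_add_three]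
  simp only [Finset.mul_sum]
  rw [Finset.sum_comm, Finset.sum_congr rfl h2, ← Finset.sum_div, Finset.sum_sub_distrib,
    hS.sum_neg_one_pow_leftCount hodd, Finset.sum_const, nsmul_eq_mul, card_offDiag_cast,
    hodd.neg_one_pow]
  ring

end Moments

theorem mainTheorem7 (n : ℕ) (hn : 4 ≤ n) (S : Finset Plane) (hcard : S.card = n)
    (hS : InGeneralPosition S) :
    (circlePolynomial S).eval 1 = (n.choose 3 : ℂ) ∧
    (Polynomial.derivative (circlePolynomial S)).eval 1 =
      (n.choose 4 : ℂ) + (rectilinearCrossingNumber S : ℂ) ∧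
    (Polynomial.derivative (Polynomial.derivative (circlePolynomial S))).eval 1 =
      (n.choose 5 : ℂ) + ((n : ℂ) - 4) * (rectilinearCrossingNumber S : ℂ) ∧
    (Odd n → (circlePolynomial S).eval (-1) = ((n : ℂ) - 1) / 2) := by
  subst hcard
  rw [hS.circlePolynomial_eq]
  refine ⟨?_, ?_, ?_, fun hodd => ?_⟩
  · simp [Polynomial.eval_finsetSum]
  · have h := hS.cast_sum_insideCount_choose 1
    rw [hS.sum_leftCount_choose_two hn] at h
    simp only [Nat.choose_one_right] at h
    simp only [Polynomial.derivative_sum, Polynomial.eval_finsetSum, Polynomial.derivative_X_pow,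
      Polynomial.eval_mul, Polynomial.eval_pow, Polynomial.eval_X, one_pow, mul_one,
      Polynomial.eval_C]
    rw [h]
    ring
  · have h := hS.cast_sum_insideCount_choose 2
    have h2 := hS.sum_leftCount_choose_three hn
    have h3 : ∀ k : ℕ, (Polynomial.derivative (Polynomial.derivative
        (Polynomial.X ^ k : Polynomial ℂ))).eval 1 = 2 * (k.choose 2 : ℂ) := by
      intro k
      rw [Nat.cast_choose_two]
      cases k <;> simp [Polynomial.derivative_X_pow]
      ring
    simp only [Polynomial.derivative_sum, Polynomial.eval_finsetSum, h3]
    rw [← Finset.mul_sum, h]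
    linear_combination h2
  · rw [← hS.sum_neg_one_pow_insideCount hodd]
    simp [Polynomial.eval_finsetSum]
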